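/- Let $d\ge 4$. Let $\mathbb{R}[x_1,x_2]_n$ be the space of real binary forms of degree $n$ (including $0$), put $V=\mathbb{R}[x_1,x_2]_d$, and let $\Sigma_{2d}\subset\mathbb{R}[x_1,x_2]_{2d}$ be the cone of sums of squares of elements of $V$. For $f\in\Sigma_{2d}$ let $\mathrm{Gram}(f)$ be the set of all symmetric tensors $\theta\in V\otimes V$ that are positive semidefinite (that is, $\sum_i\lambda(v_i)\lambda(w_i)\ge 0$ for every $\lambda\in V^*$, where $\theta=\sum_i v_i\otimes w_i$) and are mapped to $f$ by the multiplication map $v\otimes w\mapsto vw$. The rank of $\theta=\sum_i v_i\otimes w_i$ is the rank of the linear map $V^*\to V$, $\lambda\mapsto\sum_i\lambda(v_i)w_i$. Let $\mathrm{Ex}_2(f)$ be the set of extreme points of $\mathrm{Gram}(f)$ of rank two. A face of a convex set $K$ is a convex subset $F\subset K$ such that $x,y\in K$, $0<t<1$ and $(1-t)x+ty\in F$ imply $x,y\in F$; the boundary of $\mathrm{Gram}(f)$ is its boundary relative to its affine hull. Then there is an open dense subset $U$ of $\Sigma_{2d}$ such that the following hold for every $f\in U$. (a) If $d=4$, then $\mathrm{Ex}_2(f)$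 has exactly $8$ elements, and for each of the $\binom{8}{2}=28$ pairs $\theta\ne\theta'$ in $\mathrm{Ex}_2(f)$ the segment $[\theta,\theta']$ is contained in the boundary of $\mathrm{Gram}(f)$. For precisely $16$ of these pairs, $[\theta,\theta']$ is a face (an edge) of $\mathrm{Gram}(f)$. The graph with vertex set $\mathrm{Ex}_2(f)$ whose edges are these $16$ pairs is isomorphic to the complete bipartite graph $K_{4,4}$. (b) If $d\ge 5$, then for any two $\theta\ne\theta'$ in $\mathrm{Ex}_2(f)$ the segment $[\theta,\theta']$ is a face (an edge) of $\mathrm{Gram}(f)$. -/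

import Mathlib

open scoped TensorProduct

namespace GramSpectrahedron

noncomputable section

/-! ### Symmetric tensors -/

section Tensors

variable {V : Type*} [AddCommGroup V] [Module ℝ V]

/-- A tensor in `V ⊗ V` is symmetric if it is fixed by the involution `v ⊗ w ↦ w ⊗ v`. -/
def IsSymmetric (θ : V ⊗[ℝ] V) : Prop :=
  TensorProduct.comm ℝ V V θ = θ

/-- The linear map `V* → V` of a tensor: for `θ = ∑ vᵢ ⊗ wᵢ` it is `l ↦ ∑ l(vᵢ) wᵢ`
(see `tensorMap_tmul`). -/
def tensorMap (θ : V ⊗[ℝ] V) : Module.Dual ℝ V →ₗ[ℝ] V :=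
  dualTensorHom ℝ (Module.Dual ℝ V) V ((Module.Dual.eval ℝ V).rTensor V θ)

theorem tensorMap_tmul (v w : V) (l : Module.Dual ℝ V) :
    tensorMap (v ⊗ₜ[ℝ] w) l = l v • w := by
  simp [tensorMap]

theorem tensorMap_add (θ η : V ⊗[ℝ] V) : tensorMap (θ + η) = tensorMap θ + tensorMap η := by
  simp [tensorMap]

/-- The rank of a tensor: the dimension of the image of the associated map `V* → V`. -/
def tensorRank (θ : V ⊗[ℝ] V) : ℕ :=
  Module.finrank ℝ (LinearMap.range (tensorMap θ))

/-- Positive semidefinite symmetric tensors. -/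
def IsPsd (θ : V ⊗[ℝ] V) : Prop :=
  IsSymmetric θ ∧ ∀ l : Module.Dual ℝ V, 0 ≤ l (tensorMap θ l)

end Tensors

/-! ### Convex geometry -/

section Convex

variable {E : Type*} [AddCommGroup E] [Module ℝ E]

/-- A face of a convex set: a convex subset `F ⊆ K` such that `x, y ∈ K`, `0 < t < 1` and
`(1 - t) x + t y ∈ F` imply `x, y ∈ F`. -/
def IsFace (K F : Set E) : Prop :=
  Convex ℝ F ∧ IsExtreme ℝ K F

/-- The boundary of a convex set relative to its affine hull. The topology is the canonical
vector space topology (used here for finite-dimensional `E`). -/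
def relBoundary (K : Set E) : Set E :=
  letI : TopologicalSpace E := moduleTopology ℝ E
  intrinsicFrontier ℝ K

/-- `U` is an open dense subset of `S`, in the topology that `S` inherits from the canonical
vector space topology (used here for finite-dimensional `E`). -/
def IsOpenDenseIn (U S : Set E) : Prop :=
  letI : TopologicalSpace E := moduleTopology ℝ E
  (∃ O : Set E, IsOpen O ∧ U = S ∩ O) ∧ S ⊆ closure U

end Convex

/-! ### Gram spectrahedra -/

section Gram

variable {A : Type*} [CommRing A] [Algebra ℝ A]

/-- The multiplication map `V ⊗ V → A`, `p ⊗ q ↦ p q`, for a linear subspace `V` of `A`. -/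
def mulMap (V : Submodule ℝ A) : V ⊗[ℝ] V →ₗ[ℝ] A :=
  LinearMap.mul' ℝ A ∘ₗ TensorProduct.map V.subtype V.subtype

theorem mulMap_tmul (V : Submodule ℝ A) (p q : V) : mulMap V (p ⊗ₜ[ℝ] q) = (p : A) * q := by
  simp [mulMap]

/-- The Gram spectrahedron of `f` relative to `V`: all psd symmetric tensors over `V` that are
mapped to `f` by multiplication. -/
def gramRel (V : Submodule ℝ A) (f : A) : Set (V ⊗[ℝ] V) :=
  {θ | IsPsd θ ∧ mulMap V θ = f}

/-- The set of sums of squares of elements of `V`. -/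
def sumsOfSquares (V : Submodule ℝ A) : Set A :=
  {f | ∃ (r : ℕ) (p : Fin r → V), f = ∑ i, (p i : A) ^ 2}

end Gram

/-! ### Binary forms -/

/-- The space of real binary forms of degree `n`. -/
abbrev binaryForms (n : ℕ) : Submodule ℝ (MvPolynomial (Fin 2) ℝ) :=
  MvPolynomial.homogeneousSubmodule (Fin 2) ℝ n

/-- The sums of squares cone in the space of binary forms of degree `2 d`. -/
def sosCone (d : ℕ) : Set (binaryForms (2 * d)) :=
  {f | (f : MvPolynomial (Fin 2) ℝ) ∈ sumsOfSquares (binaryForms d)}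

/-- The (full) Gram spectrahedron of a binary form of degree `2 d`. -/
def gram {d : ℕ} (f : binaryForms (2 * d)) : Set (binaryForms d ⊗[ℝ] binaryForms d) :=
  gramRel (binaryForms d) (f : MvPolynomial (Fin 2) ℝ)

/-- The set of extreme points of rank `r` of the Gram spectrahedron. -/
def exRank {d : ℕ} (r : ℕ) (f : binaryForms (2 * d)) :
    Set (binaryForms d ⊗[ℝ] binaryForms d) :=
  {θ | θ ∈ (gram f).extremePoints ℝ ∧ tensorRank θ = r}

/-- The graph on the extreme points of rank two in which two distinct points are adjacent if the
segment between them is an edge (a face) of the Gram spectrahedron. -/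
def edgeGraph {d : ℕ} (f : binaryForms (2 * d)) : SimpleGraph (exRank 2 f) where
  Adj θ η := θ ≠ η ∧ IsFace (gram f) (segment ℝ θ.1 η.1)
  symm := ⟨fun θ η h => ⟨h.1.symm, by rw [segment_symm]; exact h.2⟩⟩
  loopless := ⟨fun _ h => h.1 rfl⟩

end

end GramSpectrahedron

namespace GramSpectrahedron

noncomputable section

/-! ### Tensors supported on a linearly independent family -/

section Tensors

variable {V : Type*} [AddCommGroup V] [Module ℝ V]

/-! A psd tensor of rank two is `p ⊗ p + q ⊗ q`, and it lies over `f` exactly when `f = g ḡ` with `g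
= p + i q` (`cplx`, after dehomogenizing). Multiplying `g` by a unimodular constant, or conjugating
it, does not change the tensor. A generic sum of squares has `2 d` distinct roots `z j` and their
conjugates, so `g` amounts to choosing one root from each pair. Complementary choices give the same
tensor, and all the tensors so obtained are extreme (`exRank_two_eq_range`).

For two choices put `g = a b` and `h = a b̄`, where `a` collects the roots on which they agree and
`b` those on which they differ. Both tensors are supported on the four products `aᵢ bⱼ` of real and
imaginary parts. The segment joining them consists of the psd members of the pencil given by the
relation `(a₁b₂)(a₂b₁) = (a₁b₁)(a₂b₂)`. If a point of the segment is a proper convex combination of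
two Gram tensors, these are supported on the span of the products too. Hence the segment is a face
exactly when the products satisfy no further quadratic relation.

If `b` has at least three roots there is none: at a root of `b` one has `b₁ = -i b₂`, so a relation
restricts to a binary quadratic form in `a₁, a₂` vanishing at three points of the projective line
(`SeparatedRoots.isFace`). Complementing one choice exchanges the roles of `a` and `b`, so it is
enough that one of them has degree at least three, which is automatic for `d ≥ 5`. For `d = 4` this
leaves the split `2 + 2`. There the four quadratic forms lie in a space of dimension three, so after
rotation `a₁` and `b₁` are proportional, and a dimension count gives a second relation
(`exists_relation_of_common`). Splits `1 + 3` join choices of opposite parity, whence `K_{4,4}`.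

Segments lie in the boundary because four forms cannot span a space of dimension `d + 1 ≥ 5`.
Genericity is the nonvanishing of a symmetric polynomial in the roots, that is, of a polynomial in
the normalized coefficients, which is an open and dense condition. -/

theorem tensorMap_smul (c : ℝ) (θ : V ⊗[ℝ] V) : tensorMap (c • θ) = c • tensorMap θ := by
  simp [tensorMap]

theorem tensorMap_sum {ι : Type*} (s : Finset ι) (θ : ι → V ⊗[ℝ] V) :
    tensorMap (∑ i ∈ s, θ i) = ∑ i ∈ s, tensorMap (θ i) := by
  simp [tensorMap]

/-- The evaluation `V → V**` is injective and remains so after tensoring with the flat module `V`.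
-/
theorem tensorMap_injective [FiniteDimensional ℝ V] :
    Function.Injective (tensorMap : V ⊗[ℝ] V → _) := by
  intro θ η h
  have h1 := (dualTensorHom_bijective (R := ℝ) (M := Module.Dual ℝ V) (N := V)).1 h
  refine Module.Flat.rTensor_preserves_injective_linearMap (M := V) (Module.Dual.eval ℝ V) ?_ h1
  exact Module.eval_apply_injective ℝ

theorem IsSymmetric.apply_comm {θ : V ⊗[ℝ] V} (h : IsSymmetric θ) (l m : Module.Dual ℝ V) :
    m (tensorMap θ l) = l (tensorMap θ m) := by
  have key : ∀ η : V ⊗[ℝ] V, m (tensorMap (TensorProduct.comm ℝ V V η) l) = l (tensorMap η m) := by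
    intro η
    induction η with
    | zero => simp [tensorMap]
    | tmul x y => simp [tensorMap_tmul, mul_comm]
    | add x y hx hy => simp [tensorMap_add, hx, hy]
  rw [← key, h]

/-- Isotropic vectors of a psd form lie in its kernel: along `l + t m` the form is a nonnegative
quadratic polynomial in `t` without constant term, so its linear coefficient vanishes. -/
theorem IsPsd.apply_eq_zero {θ : V ⊗[ℝ] V} (h : IsPsd θ) {l : Module.Dual ℝ V}
    (hl : l (tensorMap θ l) = 0) : tensorMap θ l = 0 := by
  by_contra hne
  obtain ⟨m, hm⟩ : ∃ m : Module.Dual ℝ V, m (tensorMap θ l) ≠ 0 := by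
    by_contra! hcon
    exact hne ((Module.forall_dual_apply_eq_zero_iff ℝ _).1 hcon)
  have hq : ∀ t : ℝ, 0 ≤ m (tensorMap θ m) * (t * t) + 2 * m (tensorMap θ l) * t + 0 := by
    intro t
    have := h.2 (l + t • m)
    simp only [map_add, map_smul, LinearMap.add_apply, LinearMap.smul_apply, smul_eq_mul, hl] at this
    rw [h.1.apply_comm m l] at this
    linarith
  have := discrim_le_zero hq
  rw [discrim] at this
  have h2 : 0 < (m (tensorMap θ l)) ^ 2 := by positivity
  nlinarith

variable {ι : Type*} [Fintype ι]

/-- The tensor `∑ cᵢⱼ uᵢ ⊗ uⱼ`. -/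
def gramTensor (u : ι → V) (c : Matrix ι ι ℝ) : V ⊗[ℝ] V :=
  ∑ i, ∑ j, c i j • (u i ⊗ₜ[ℝ] u j)

theorem tensorMap_gramTensor (u : ι → V) (c : Matrix ι ι ℝ) (l : Module.Dual ℝ V) :
    tensorMap (gramTensor u c) l = ∑ i, ∑ j, (c i j * l (u i)) • u j := by
  simp [gramTensor, tensorMap_sum, tensorMap_smul, tensorMap_tmul, LinearMap.sum_apply, mul_smul]

theorem apply_tensorMap_gramTensor (u : ι → V) (c : Matrix ι ι ℝ) (l m : Module.Dual ℝ V) :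
    m (tensorMap (gramTensor u c) l) = ∑ i, ∑ j, c i j * l (u i) * m (u j) := by
  simp [tensorMap_gramTensor]

theorem gramTensor_add (u : ι → V) (c e : Matrix ι ι ℝ) :
    gramTensor u (c + e) = gramTensor u c + gramTensor u e := by
  simp [gramTensor, add_smul, Finset.sum_add_distrib]

theorem gramTensor_smul (u : ι → V) (t : ℝ) (c : Matrix ι ι ℝ) :
    gramTensor u (t • c) = t • gramTensor u c := by
  simp [gramTensor, Finset.smul_sum, mul_smul]

theorem gramTensor_injective {u : ι → V} (hu : LinearIndependent ℝ u) :
    Function.Injective (gramTensor u) := by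
  intro c e h
  have := LinearIndependent.tmul_of_flat_left hu hu
  rw [Fintype.linearIndependent_iff] at this
  have h0 := this (fun p => c p.1 p.2 - e p.1 p.2) (by
    simp only [sub_smul, Finset.sum_sub_distrib, Fintype.sum_prod_type]
    exact sub_eq_zero.2 h)
  ext i j
  exact sub_eq_zero.1 (h0 (i, j))

theorem isSymmetric_gramTensor (u : ι → V) {c : Matrix ι ι ℝ} (hc : c.IsSymm) :
    IsSymmetric (gramTensor u c) := by
  unfold IsSymmetric gramTensor
  simp only [map_sum, map_smul, TensorProduct.comm_tmul]
  rw [Finset.sum_comm]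
  refine Finset.sum_congr rfl fun i _ => Finset.sum_congr rfl fun j _ => ?_
  rw [hc.apply]

theorem isPsd_gramTensor (u : ι → V) {c : Matrix ι ι ℝ} (hc : c.IsSymm)
    (h : ∀ y : ι → ℝ, 0 ≤ ∑ i, ∑ j, c i j * y i * y j) : IsPsd (gramTensor u c) :=
  ⟨isSymmetric_gramTensor u hc, fun l => by
    rw [apply_tensorMap_gramTensor]; exact h fun i => l (u i)⟩

theorem exists_dual_of_linearIndependent {u : ι → V} (hu : LinearIndependent ℝ u) (y : ι → ℝ) :
    ∃ l : Module.Dual ℝ V, ∀ i, l (u i) = y i := by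
  classical
  obtain ⟨g, hg⟩ := LinearMap.exists_leftInverse_of_injective _
    (LinearMap.ker_eq_bot.2 hu.fintypeLinearCombination_injective)
  refine ⟨(Fintype.linearCombination ℝ y) ∘ₗ g, fun i => ?_⟩
  have := LinearMap.congr_fun hg (Pi.single i 1)
  simp only [LinearMap.comp_apply, Fintype.linearCombination_apply_single, one_smul,
    LinearMap.id_apply] at this
  simp [this, Fintype.linearCombination_apply_single]

theorem IsPsd.nonneg_of_gramTensor {u : ι → V} (hu : LinearIndependent ℝ u) {c : Matrix ι ι ℝ}
    (h : IsPsd (gramTensor u c)) (y : ι → ℝ) : 0 ≤ ∑ i, ∑ j, c i j * y i * y j := by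
  obtain ⟨l, hl⟩ := exists_dual_of_linearIndependent hu y
  have := h.2 l
  simpa [apply_tensorMap_gramTensor, hl] using this

/-- A symmetric tensor whose map takes values in the span of `u` is a combination of the
`uᵢ ⊗ uⱼ`. -/
theorem IsSymmetric.exists_gramTensor [FiniteDimensional ℝ V] {u : ι → V}
    (hu : LinearIndependent ℝ u) {θ : V ⊗[ℝ] V} (h : IsSymmetric θ)
    (hr : ∀ l, tensorMap θ l ∈ Submodule.span ℝ (Set.range u)) :
    ∃ c : Matrix ι ι ℝ, c.IsSymm ∧ θ = gramTensor u c := by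
  classical
  -- The `L i` are dual to `u`, so the coefficients have to be `c i j = L j (θ (L i))`.
  choose L hL using fun i => exists_dual_of_linearIndependent hu (Pi.single i 1)
  have hexp : ∀ v ∈ Submodule.span ℝ (Set.range u), v = ∑ j, L j v • u j := by
    intro v hv
    induction hv using Submodule.span_induction with
    | mem x hx =>
      obtain ⟨i, rfl⟩ := hx
      rw [Finset.sum_eq_single i] <;> simp +contextual [hL]
    | zero => simp
    | add x y _ _ hx hy => simp only [map_add, add_smul, Finset.sum_add_distrib, ← hx, ← hy]
    | smul a x _ hx => simp only [map_smul, smul_eq_mul, mul_smul, ← Finset.smul_sum, ← hx]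
  refine ⟨Matrix.of fun i j => L j (tensorMap θ (L i)), ?_, ?_⟩
  · ext i j; exact h.apply_comm _ _
  · apply tensorMap_injective
    ext m
    rw [tensorMap_gramTensor, hexp _ (hr m), Finset.sum_comm]
    refine Finset.sum_congr rfl fun j _ => ?_
    rw [← Finset.sum_smul]
    congr 1
    simp only [Matrix.of_apply]
    rw [h.apply_comm, hexp _ (hr (L j))]
    simp only [map_sum, map_smul, smul_eq_mul]
    exact Finset.sum_congr rfl fun i _ => by rw [h.apply_comm]

/-- A functional killing every `u i` is isotropic for the sum, hence for the psd summand `x`, hence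
in the kernel of `x`; by symmetry it kills the range of `x`. This confines the points of a face to a
fixed support. -/
theorem IsPsd.exists_gramTensor_of_add [FiniteDimensional ℝ V] {u : ι → V}
    (hu : LinearIndependent ℝ u) {x y : V ⊗[ℝ] V} (hx : IsPsd x) (hy : IsPsd y) {a b : ℝ}
    (ha : 0 < a) (hb : 0 ≤ b) {c : Matrix ι ι ℝ} (h : a • x + b • y = gramTensor u c) :
    ∃ e : Matrix ι ι ℝ, e.IsSymm ∧ x = gramTensor u e := by
  refine hx.1.exists_gramTensor hu fun l => ?_
  by_contra hl
  obtain ⟨m, hm, hm'⟩ := Submodule.exists_dual_map_eq_bot_of_notMem hl inferInstance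
  have hmu : ∀ i, m (u i) = 0 := fun i => by
    have : m (u i) ∈ Submodule.map m (Submodule.span ℝ (Set.range u)) :=
      Submodule.mem_map_of_mem (Submodule.subset_span ⟨i, rfl⟩)
    rwa [hm', Submodule.mem_bot] at this
  have h0 : m (tensorMap (a • x + b • y) m) = 0 := by
    rw [h, apply_tensorMap_gramTensor]; simp [hmu]
  simp only [tensorMap_add, tensorMap_smul, LinearMap.add_apply, LinearMap.smul_apply, map_add,
    map_smul, smul_eq_mul] at h0
  have h1 := hx.2 m
  have h2 := mul_nonneg hb (hy.2 m)
  have h3 : m (tensorMap x m) = 0 := by nlinarith [mul_nonneg ha.le h1]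
  apply hm
  rw [hx.1.apply_comm, hx.apply_eq_zero h3, map_zero]

/-- The psd tensor `p ⊗ p + q ⊗ q`. -/
def sqTensor (p q : V) : V ⊗[ℝ] V := p ⊗ₜ[ℝ] p + q ⊗ₜ[ℝ] q

theorem sqTensor_eq_gramTensor (p q : V) : sqTensor p q = gramTensor ![p, q] 1 := by
  simp [sqTensor, gramTensor, Fin.sum_univ_two, Matrix.one_apply]

theorem tensorMap_sqTensor (p q : V) (l : Module.Dual ℝ V) :
    tensorMap (sqTensor p q) l = l p • p + l q • q := by
  simp [sqTensor, tensorMap_add, tensorMap_tmul]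

theorem isPsd_sqTensor (p q : V) : IsPsd (sqTensor p q) := by
  refine ⟨by simp [IsSymmetric, sqTensor], fun l => ?_⟩
  rw [tensorMap_sqTensor]
  simp only [map_add, map_smul, smul_eq_mul]
  nlinarith [mul_self_nonneg (l p), mul_self_nonneg (l q)]

/-- The new pair is the real and imaginary part of `(a + i b)(p + i q)`. -/
theorem sqTensor_rotate (p q : V) {a b : ℝ} (h : a ^ 2 + b ^ 2 = 1) :
    sqTensor (a • p - b • q) (b • p + a • q) = sqTensor p q := by
  have h2 : b * b = 1 - a * a := by linarith
  simp only [sqTensor, TensorProduct.add_tmul, TensorProduct.tmul_add, TensorProduct.sub_tmul,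
    TensorProduct.tmul_sub, ← TensorProduct.smul_tmul', TensorProduct.tmul_smul]
  match_scalars <;> linarith

theorem sqTensor_neg_right (p q : V) : sqTensor p (-q) = sqTensor p q := by
  simp [sqTensor, TensorProduct.neg_tmul, TensorProduct.tmul_neg]

theorem tensorRank_sqTensor {p q : V} (h : LinearIndependent ℝ ![p, q]) :
    tensorRank (sqTensor p q) = 2 := by
  have hrange : LinearMap.range (tensorMap (sqTensor p q)) =
      Submodule.span ℝ (Set.range ![p, q]) := by
    apply le_antisymm
    · rintro _ ⟨l, rfl⟩
      rw [tensorMap_sqTensor]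
      exact add_mem (Submodule.smul_mem _ _ (Submodule.subset_span ⟨0, rfl⟩))
        (Submodule.smul_mem _ _ (Submodule.subset_span ⟨1, rfl⟩))
    · rw [Submodule.span_le]
      rintro _ ⟨i, rfl⟩
      obtain ⟨l, hl⟩ := exists_dual_of_linearIndependent h (Pi.single i 1)
      refine ⟨l, ?_⟩
      have h0 := hl 0
      have h1 := hl 1
      simp only [Matrix.cons_val_zero, Matrix.cons_val_one] at h0 h1
      rw [tensorMap_sqTensor, h0, h1]
      fin_cases i <;> simp
  rw [tensorRank, hrange, finrank_span_eq_card h, Fintype.card_fin]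

/-- A psd tensor of rank two is a sum of two squares. -/
theorem IsPsd.exists_sqTensor [FiniteDimensional ℝ V] {θ : V ⊗[ℝ] V} (h : IsPsd θ)
    (hr : tensorRank θ = 2) : ∃ p q : V, θ = sqTensor p q := by
  let B := Module.finBasisOfFinrankEq ℝ _ hr
  let u : Fin 2 → V := fun i => (B i : V)
  have hu : LinearIndependent ℝ u :=
    B.linearIndependent.map' (Submodule.subtype _) (Submodule.ker_subtype _)
  have hspan : LinearMap.range (tensorMap θ) ≤ Submodule.span ℝ (Set.range u) := by
    have : Submodule.span ℝ (Set.range u) =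
        (Submodule.span ℝ (Set.range B)).map (Submodule.subtype _) := by
      rw [Submodule.map_span, ← Set.range_comp]; rfl
    rw [this, B.span_eq, Submodule.map_top, Submodule.range_subtype]
  obtain ⟨c, hc, hθ⟩ := h.1.exists_gramTensor hu fun l => hspan ⟨l, rfl⟩
  have hn := (hθ ▸ h).nonneg_of_gramTensor hu
  have h10 : c 1 0 = c 0 1 := hc.apply 0 1
  simp only [Fin.sum_univ_two, h10] at hn
  have hexp : gramTensor u c = c 0 0 • (u 0 ⊗ₜ[ℝ] u 0) + c 0 1 • (u 0 ⊗ₜ[ℝ] u 1) +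
      (c 0 1 • (u 1 ⊗ₜ[ℝ] u 0) + c 1 1 • (u 1 ⊗ₜ[ℝ] u 1)) := by
    simp [gramTensor, Fin.sum_univ_two, h10]
  rw [hθ, hexp]
  clear hexp hθ h10
  generalize c 0 0 = α at *
  generalize c 0 1 = β at *
  generalize c 1 1 = γ at *
  have hα : 0 ≤ α := by simpa using hn ![1, 0]
  have hγ : 0 ≤ γ := by simpa using hn ![0, 1]
  have hdet : β ^ 2 ≤ α * γ := by
    have := discrim_le_zero (a := α) (b := 2 * β) (c := γ) fun t => by
      have := hn ![t, 1]
      simp at this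
      linarith
    rw [discrim] at this
    linarith
  rcases hα.eq_or_lt with h0 | h0
  · have hβ : β = 0 := by
      rw [← h0, zero_mul] at hdet
      exact pow_eq_zero_iff two_ne_zero |>.1 (le_antisymm hdet (sq_nonneg _))
    refine ⟨0, √γ • u 1, ?_⟩
    simp [sqTensor, ← h0, hβ, ← TensorProduct.smul_tmul', TensorProduct.tmul_smul, smul_smul,
      Real.mul_self_sqrt hγ]
  · have hs : √α * √α = α := Real.mul_self_sqrt hα
    have hs0 : √α ≠ 0 := (Real.sqrt_pos.2 h0).ne'
    have hδ : 0 ≤ γ - β ^ 2 / α := by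
      rw [sub_nonneg, div_le_iff₀ h0]; linarith
    -- Completing the square: `αx² + 2βxy + γy² = (√α x + (β/√α) y)² + (γ - β²/α) y²`.
    refine ⟨√α • u 0 + (β / √α) • u 1, √(γ - β ^ 2 / α) • u 1, ?_⟩
    have h1 : √α * (β / √α) = β := by field_simp
    have h2 : β / √α * (β / √α) = β ^ 2 / α := by rw [div_mul_div_comm, hs, sq]
    have h3 := Real.mul_self_sqrt hδ
    simp only [sqTensor, TensorProduct.add_tmul, TensorProduct.tmul_add, ← TensorProduct.smul_tmul',
      TensorProduct.tmul_smul, smul_smul]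
    match_scalars <;> linarith

end Tensors

/-! ### Binary forms as univariate polynomials -/

section Dehomogenization

open Polynomial

/-- Dehomogenization `x₁ ↦ X`, `x₂ ↦ 1` of real binary forms, with complex coefficients. -/
def dehom : MvPolynomial (Fin 2) ℝ →ₐ[ℝ] ℂ[X] :=
  (Polynomial.mapAlgHom (Algebra.ofId ℝ ℂ)).comp (MvPolynomial.aeval ![X, 1])

theorem dehom_apply (p : MvPolynomial (Fin 2) ℝ) :
    dehom p = (MvPolynomial.aeval ![(X : ℝ[X]), 1] p).map (algebraMap ℝ ℂ) := rfl

theorem dehom_homogenize {P : ℝ[X]} {n : ℕ} (h : P.natDegree ≤ n) :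
    dehom (P.homogenize n) = P.map (algebraMap ℝ ℂ) := by
  rw [dehom_apply, aeval_homogenize_X_one P h]

theorem natDegree_aeval_le {n : ℕ} {p : MvPolynomial (Fin 2) ℝ} (hp : p ∈ binaryForms n) :
    (MvPolynomial.aeval ![(X : ℝ[X]), 1] p).natDegree ≤ n := by
  rw [p.as_sum, map_sum]
  refine natDegree_sum_le_of_forall_le _ _ fun m hm => ?_
  have hm' : m 0 + m 1 = n := by
    have := (MvPolynomial.mem_homogeneousSubmodule _ _).1 hp (by simpa using hm)
    simpa [Finsupp.weight_apply, Finsupp.sum_fintype, Fin.sum_univ_two] using this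
  rw [MvPolynomial.aeval_monomial, Finsupp.prod_fintype _ _ (by simp)]
  simp only [Fin.prod_univ_two, Matrix.cons_val_zero, Matrix.cons_val_one, one_pow, mul_one]
  exact (natDegree_C_mul_X_pow_le _ _).trans (by omega)

theorem natDegree_dehom_le {n : ℕ} (p : binaryForms n) : (dehom p).natDegree ≤ n :=
  natDegree_map_le.trans (natDegree_aeval_le p.2)

theorem dehom_injective {n : ℕ} {p q : binaryForms n}
    (h : dehom p = dehom q) : p = q := by
  have h1 := Polynomial.map_injective _ (algebraMap ℝ ℂ).injective h
  apply Subtype.ext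
  rw [← homogenize_eq_of_isHomogeneous p.2 rfl, ← homogenize_eq_of_isHomogeneous q.2 rfl]
  exact congrArg (homogenize · n) h1

theorem dehom_smul (c : ℝ) (p : MvPolynomial (Fin 2) ℝ) : dehom (c • p) = C (c : ℂ) * dehom p := by
  rw [map_smul, ← smul_eq_C_mul]
  ext i
  simp

theorem star_dehom (p : MvPolynomial (Fin 2) ℝ) :
    (dehom p).map (starRingEnd ℂ) = dehom p := by
  rw [dehom_apply, Polynomial.map_map]
  congr 1
  ext x; simp

theorem exists_dehom_eq {n : ℕ} {P : ℝ[X]} (h : P.natDegree ≤ n) :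
    ∃ p : binaryForms n, dehom p = P.map (algebraMap ℝ ℂ) :=
  ⟨⟨P.homogenize n, isHomogeneous_homogenize P⟩, dehom_homogenize h⟩

/-- Binary forms of degree `n` are polynomials of degree at most `n`. -/
def formsEquiv (n : ℕ) : binaryForms n ≃ₗ[ℝ] degreeLT ℝ (n + 1) :=
  LinearEquiv.ofBijective
    (((MvPolynomial.aeval ![(X : ℝ[X]), 1]).toLinearMap ∘ₗ (binaryForms n).subtype).codRestrict _
      fun p => by
        rw [mem_degreeLT]
        exact lt_of_le_of_lt (degree_le_natDegree)
          (by exact_mod_cast Nat.lt_succ_of_le (natDegree_aeval_le p.2)))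
    ⟨fun p q h => dehom_injective (by
        have := congrArg Subtype.val h
        exact congrArg (Polynomial.map (algebraMap ℝ ℂ)) this),
     fun P => by
        have h : (P : ℝ[X]).natDegree ≤ n := by
          have := mem_degreeLT.1 P.2
          rw [← Nat.lt_succ_iff]
          by_cases h0 : (P : ℝ[X]) = 0
          · simp [h0]
          · exact (natDegree_lt_iff_degree_lt h0).2 this
        exact ⟨⟨(P : ℝ[X]).homogenize n, isHomogeneous_homogenize _⟩,
          Subtype.ext (aeval_homogenize_X_one _ h)⟩⟩

instance (n : ℕ) : FiniteDimensional ℝ (binaryForms n) :=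
  ((formsEquiv n).trans (degreeLTEquiv ℝ (n + 1))).symm.finiteDimensional

theorem finrank_binaryForms (n : ℕ) : Module.finrank ℝ (binaryForms n) = n + 1 := by
  rw [((formsEquiv n).trans (degreeLTEquiv ℝ (n + 1))).finrank_eq]
  simp

/-- The complex polynomial `p + i q` of a pair of real binary forms. -/
def cplx {n : ℕ} (p q : binaryForms n) : ℂ[X] := dehom p + C Complex.I * dehom q

theorem star_cplx {n : ℕ} (p q : binaryForms n) :
    (cplx p q).map (starRingEnd ℂ) = dehom p - C Complex.I * dehom q := by
  simp [cplx, star_dehom, sub_eq_add_neg]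

theorem natDegree_cplx_le {n : ℕ} (p q : binaryForms n) : (cplx p q).natDegree ≤ n :=
  natDegree_add_le_of_degree_le (natDegree_dehom_le p)
    ((natDegree_C_mul_le _ _).trans (natDegree_dehom_le q))

theorem C_I_sq : (C Complex.I : ℂ[X]) ^ 2 = -1 := by
  rw [← C_pow, Complex.I_sq, C_neg, C_1]

/-- Sums of two squares become factorizations `g ḡ`. -/
theorem cplx_mul_star {n : ℕ} (p q : binaryForms n) :
    cplx p q * (cplx p q).map (starRingEnd ℂ) = dehom p ^ 2 + dehom q ^ 2 := by
  rw [star_cplx, cplx]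
  linear_combination (-dehom q ^ 2) * C_I_sq

theorem two_mul_dehom_left {n : ℕ} (p q : binaryForms n) :
    2 * dehom p = cplx p q + (cplx p q).map (starRingEnd ℂ) := by
  rw [star_cplx, cplx]; ring

theorem two_mul_dehom_right {n : ℕ} (p q : binaryForms n) :
    2 * dehom q = C Complex.I * ((cplx p q).map (starRingEnd ℂ) - cplx p q) := by
  rw [star_cplx, cplx]
  linear_combination (2 * dehom q) * C_I_sq

theorem cplx_injective {n : ℕ} {p q p' q' : binaryForms n} (h : cplx p q = cplx p' q') :
    p = p' ∧ q = q' := by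
  constructor <;> apply dehom_injective <;>
    apply mul_left_cancel₀ (two_ne_zero (α := ℂ[X]))
  · rw [two_mul_dehom_left p q, two_mul_dehom_left p' q', h]
  · rw [two_mul_dehom_right p q, two_mul_dehom_right p' q', h]

theorem exists_cplx {n : ℕ} {g : ℂ[X]} (h : g.natDegree ≤ n) :
    ∃ p q : binaryForms n, cplx p q = g := by
  let R (u : ℂ → ℝ) : ℝ[X] := ∑ i ∈ Finset.range (n + 1), monomial i (u (g.coeff i))
  have hR : ∀ u, (R u).natDegree ≤ n := fun u =>
    natDegree_sum_le_of_forall_le _ _ fun i hi =>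
      (natDegree_monomial_le _).trans (Nat.lt_succ_iff.1 (Finset.mem_range.1 hi))
  obtain ⟨p, hp⟩ := exists_dehom_eq (hR Complex.re)
  obtain ⟨q, hq⟩ := exists_dehom_eq (hR Complex.im)
  refine ⟨p, q, ?_⟩
  rw [cplx, hp, hq]
  conv_rhs => rw [g.as_sum_range' (n + 1) (Nat.lt_succ_of_le h)]
  simp only [R, Polynomial.map_sum, map_monomial, Finset.mul_sum, C_mul_monomial,
    ← Finset.sum_add_distrib]
  refine Finset.sum_congr rfl fun i _ => ?_
  rw [← map_add, mul_comm]
  exact congrArg _ (Complex.re_add_im _)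

end Dehomogenization

/-! ### The pencil of Gram tensors spanned by two factorizations -/

section Pencil

open Polynomial

/-- Cramer's rule: a linear form with two distinct zeros on the projective line vanishes. -/
theorem binary_linear_eq_zero {α β : ℂ} {x y : Fin 2 → ℂ}
    (h : ∀ i j, i ≠ j → x i * y j - x j * y i ≠ 0) (h0 : ∀ i, α * x i + β * y i = 0) :
    α = 0 ∧ β = 0 := by
  have hd := h 0 1 (by decide)
  constructor <;> refine (mul_eq_zero.1 ?_).resolve_right hd
  · linear_combination y 1 * h0 0 - y 0 * h0 1
  · linear_combination x 0 * h0 1 - x 1 * h0 0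

/-- A binary quadratic form with three distinct zeros on the projective line vanishes. The
multipliers are cofactors of the homogeneous Vandermonde matrix with rows `(x², xy, y²)`, whose
determinant is the product of the three minors `xᵢyⱼ - xⱼyᵢ` up to sign. -/
theorem binary_quadratic_eq_zero {α β γ : ℂ} {x y : Fin 3 → ℂ}
    (h : ∀ i j, i ≠ j → x i * y j - x j * y i ≠ 0)
    (h0 : ∀ i, α * x i ^ 2 + β * (x i * y i) + γ * y i ^ 2 = 0) :
    α = 0 ∧ β = 0 ∧ γ = 0 := by
  have hd := mul_ne_zero (mul_ne_zero (h 0 1 (by decide)) (h 0 2 (by decide)))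
    (h 1 2 (by decide))
  have e0 := h0 0
  have e1 := h0 1
  have e2 := h0 2
  generalize x 0 = x0 at *
  generalize x 1 = x1 at *
  generalize x 2 = x2 at *
  generalize y 0 = y0 at *
  generalize y 1 = y1 at *
  generalize y 2 = y2 at *
  refine ⟨?_, ?_, ?_⟩ <;> refine (mul_eq_zero.1 ?_).resolve_right hd
  · linear_combination (y1 * y2 * (x1 * y2 - x2 * y1)) * e0 -
      (y0 * y2 * (x0 * y2 - x2 * y0)) * e1 + (y0 * y1 * (x0 * y1 - x1 * y0)) * e2
  · linear_combination -(x1 ^ 2 * y2 ^ 2 - x2 ^ 2 * y1 ^ 2) * e0 +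
      (x0 ^ 2 * y2 ^ 2 - x2 ^ 2 * y0 ^ 2) * e1 - (x0 ^ 2 * y1 ^ 2 - x1 ^ 2 * y0 ^ 2) * e2
  · linear_combination (x1 * x2 * (x1 * y2 - x2 * y1)) * e0 -
      (x0 * x2 * (x0 * y2 - x2 * y0)) * e1 + (x0 * x1 * (x0 * y1 - x1 * y0)) * e2

/-- The points `s i` are roots of `b = b₁ + i b₂`, but not of its conjugate, at which
`a = a₁ + i a₂` and its conjugate have pairwise different ratios. -/
structure SeparatedRoots {k m n : ℕ} (a₁ a₂ : binaryForms k) (b₁ b₂ : binaryForms m)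
    (s : Fin n → ℂ) : Prop where
  eval_eq_zero : ∀ i, (cplx b₁ b₂).eval (s i) = 0
  eval_star_ne_zero : ∀ i, ((cplx b₁ b₂).map (starRingEnd ℂ)).eval (s i) ≠ 0
  separated : ∀ i j, i ≠ j →
    (cplx a₁ a₂).eval (s i) * ((cplx a₁ a₂).map (starRingEnd ℂ)).eval (s j) ≠
      (cplx a₁ a₂).eval (s j) * ((cplx a₁ a₂).map (starRingEnd ℂ)).eval (s i)

namespace SeparatedRoots

variable {k m n : ℕ} {a₁ a₂ : binaryForms k} {b₁ b₂ : binaryForms m} {s : Fin n → ℂ}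

theorem eval_left (h : SeparatedRoots a₁ a₂ b₁ b₂ s) (i : Fin n) :
    (dehom b₁).eval (s i) = -Complex.I * (dehom b₂).eval (s i) := by
  have := h.eval_eq_zero i
  simp only [cplx, eval_add, eval_mul, eval_C] at this
  linear_combination this

theorem eval_right_ne_zero (h : SeparatedRoots a₁ a₂ b₁ b₂ s) (i : Fin n) :
    (dehom b₂).eval (s i) ≠ 0 := by
  intro h0
  apply h.eval_star_ne_zero i
  rw [star_cplx, eval_sub, eval_mul, h.eval_left i, h0]
  simp

theorem det_ne_zero (h : SeparatedRoots a₁ a₂ b₁ b₂ s) (i j : Fin n) (hij : i ≠ j) :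
    (dehom a₁).eval (s i) * (dehom a₂).eval (s j) -
      (dehom a₁).eval (s j) * (dehom a₂).eval (s i) ≠ 0 := by
  intro h0
  apply h.separated i j hij
  rw [star_cplx]
  simp only [cplx, eval_add, eval_sub, eval_mul, eval_C]
  linear_combination (-2 * Complex.I) * h0

theorem cplx_ne_zero (h : SeparatedRoots a₁ a₂ b₁ b₂ s) (i : Fin n) : cplx b₁ b₂ ≠ 0 := by
  intro h0
  apply h.eval_star_ne_zero i
  simp [h0]

theorem normSq_ne_zero (h : SeparatedRoots a₁ a₂ b₁ b₂ s) (i : Fin n) :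
    dehom b₁ ^ 2 + dehom b₂ ^ 2 ≠ 0 := by
  rw [← cplx_mul_star]
  refine mul_ne_zero (h.cplx_ne_zero i) ?_
  exact (Polynomial.map_ne_zero_iff (starRingEnd ℂ).injective).2 (h.cplx_ne_zero i)

/-- Given three separated roots, the nine products of quadratic monomials in `a₁, a₂` and in
`b₁, b₂` are linearly independent. -/
theorem products_linearIndependent {s : Fin 3 → ℂ} (h : SeparatedRoots a₁ a₂ b₁ b₂ s)
    (c : Fin 3 → Fin 3 → ℝ) (A : Fin 3 → ℂ[X])
    (hA : ∀ n, A n = C (c 0 n : ℂ) * dehom a₁ ^ 2 + C (c 1 n : ℂ) * (dehom a₁ * dehom a₂) +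
      C (c 2 n : ℂ) * dehom a₂ ^ 2)
    (h0 : A 0 * dehom b₁ ^ 2 + A 1 * (dehom b₁ * dehom b₂) + A 2 * dehom b₂ ^ 2 = 0) :
    ∀ i j, c i j = 0 := by
  -- At a root of `b` one has `b₁ = -i b₂`, so `b₁²` and `b₁b₂` become `-b₂²` and `-i b₂²`, and the
  -- nonzero factor `b₂²` cancels.
  have heval : ∀ i, (A 2).eval (s i) - (A 0).eval (s i) - Complex.I * (A 1).eval (s i) = 0 := by
    intro i
    have := congrArg (eval (s i)) h0
    simp only [eval_add, eval_mul, eval_pow, eval_zero, h.eval_left i] at this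
    refine (mul_eq_zero.1 ?_).resolve_right (pow_ne_zero 2 (h.eval_right_ne_zero i))
    linear_combination this - (A 0).eval (s i) * (dehom b₂).eval (s i) ^ 2 * Complex.I_sq
  obtain ⟨e0, e1, e2⟩ := binary_quadratic_eq_zero (α := c 0 2 - c 0 0 - Complex.I * c 0 1)
    (β := c 1 2 - c 1 0 - Complex.I * c 1 1) (γ := c 2 2 - c 2 0 - Complex.I * c 2 1)
    h.det_ne_zero (fun i => by
      have := heval i
      simp only [hA, eval_add, eval_mul, eval_pow, eval_C] at this
      linear_combination this)
  -- The coefficients `c` are real, so each complex equation splits into two.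
  have hc : ∀ x y z : ℝ, (x : ℂ) - y - Complex.I * z = 0 → x = y ∧ z = 0 := by
    intro x y z hxyz
    rw [Complex.ext_iff] at hxyz
    simp only [Complex.sub_re, Complex.ofReal_re, Complex.mul_re, Complex.I_re, Complex.ofReal_im,
      Complex.I_im, Complex.sub_im, Complex.mul_im, Complex.zero_re, Complex.zero_im] at hxyz
    constructor <;> linarith [hxyz.1, hxyz.2]
  obtain ⟨f0, g0⟩ := hc _ _ _ e0
  obtain ⟨f1, g1⟩ := hc _ _ _ e1
  obtain ⟨f2, g2⟩ := hc _ _ _ e2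
  have hA1 : A 1 = 0 := by rw [hA]; simp [g0, g1, g2]
  have hA2 : A 2 = A 0 := by rw [hA, hA]; simp [f0, f1, f2]
  -- What remains of the relation is `A 0 * (b₁² + b₂²) = 0`.
  have hA0 : A 0 = 0 := by
    refine (mul_eq_zero.1 ?_).resolve_right (h.normSq_ne_zero 0)
    rw [hA1, hA2] at h0
    linear_combination h0
  obtain ⟨k0, k1, k2⟩ := binary_quadratic_eq_zero (α := c 0 0) (β := c 1 0) (γ := c 2 0)
    h.det_ne_zero (fun i => by
      have := congrArg (eval (s i)) hA0
      simp only [hA, eval_add, eval_mul, eval_pow, eval_C, eval_zero] at this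
      exact this)
  norm_cast at k0 k1 k2
  intro i j
  fin_cases i <;> fin_cases j <;> simp [*]

end SeparatedRoots

variable {k m d : ℕ}

/-- The product of two binary forms. -/
def mulForm (hkm : k + m = d) (a : binaryForms k) (b : binaryForms m) : binaryForms d :=
  ⟨a * b, hkm ▸ MvPolynomial.IsHomogeneous.mul a.2 b.2⟩

theorem dehom_mulForm (hkm : k + m = d) (a : binaryForms k) (b : binaryForms m) :
    dehom (mulForm hkm a b) = dehom a * dehom b := by
  simp [mulForm]

/-- The four products of real and imaginary parts. -/
def prodFamily (hkm : k + m = d) (a₁ a₂ : binaryForms k) (b₁ b₂ : binaryForms m) :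
    Fin 4 → binaryForms d :=
  ![mulForm hkm a₁ b₁, mulForm hkm a₁ b₂, mulForm hkm a₂ b₁, mulForm hkm a₂ b₂]

/-- Evaluation at roots of `b` again, now giving linear forms in `a₁, a₂`, for which two points
suffice. -/
theorem linearIndependent_prodFamily (hkm : k + m = d) {a₁ a₂ : binaryForms k}
    {b₁ b₂ : binaryForms m} {s : Fin 2 → ℂ} (h : SeparatedRoots a₁ a₂ b₁ b₂ s) :
    LinearIndependent ℝ (prodFamily hkm a₁ a₂ b₁ b₂) := by
  rw [Fintype.linearIndependent_iff]
  intro c hc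
  have h0 : C (c 0 : ℂ) * (dehom a₁ * dehom b₁) + C (c 1 : ℂ) * (dehom a₁ * dehom b₂) +
      C (c 2 : ℂ) * (dehom a₂ * dehom b₁) + C (c 3 : ℂ) * (dehom a₂ * dehom b₂) = 0 := by
    have := congrArg (fun p : binaryForms d => dehom p) hc
    simpa [-map_smul, Fin.sum_univ_four, prodFamily, dehom_smul, dehom_mulForm] using this
  obtain ⟨e0, e1⟩ := binary_linear_eq_zero (α := c 1 - Complex.I * c 0)
    (β := c 3 - Complex.I * c 2) h.det_ne_zero (fun i => by
      have := congrArg (eval (s i)) h0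
      simp only [eval_add, eval_mul, eval_C, eval_zero, h.eval_left i] at this
      refine (mul_eq_zero.1 ?_).resolve_right (h.eval_right_ne_zero i)
      linear_combination this)
  have hc : ∀ x y : ℝ, (x : ℂ) - Complex.I * y = 0 → x = 0 ∧ y = 0 := by
    intro x y hxy
    rw [Complex.ext_iff] at hxy
    simp only [Complex.sub_re, Complex.ofReal_re, Complex.mul_re, Complex.I_re, Complex.ofReal_im,
      Complex.I_im, Complex.sub_im, Complex.mul_im, Complex.zero_re, Complex.zero_im] at hxy
    constructor <;> linarith [hxy.1, hxy.2]
  obtain ⟨f1, f0⟩ := hc _ _ e0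
  obtain ⟨f3, f2⟩ := hc _ _ e1
  intro i
  fin_cases i <;> assumption

theorem mulMap_gramTensor {A ι : Type*} [Fintype ι] [CommRing A] [Algebra ℝ A]
    (V : Submodule ℝ A) (u : ι → V) (c : Matrix ι ι ℝ) :
    mulMap V (gramTensor u c) = ∑ i, ∑ j, c i j • ((u i : A) * u j) := by
  simp [gramTensor, mulMap_tmul]

theorem dehom_mulMap_gramTensor {ι : Type*} [Fintype ι] (u : ι → binaryForms d)
    (c : Matrix ι ι ℝ) : dehom (mulMap _ (gramTensor u c)) =
      ∑ i, ∑ j, C (c i j : ℂ) * (dehom (u i) * dehom (u j)) := by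
  simp [-map_smul, mulMap_gramTensor, dehom_smul]

/-- The matrix of the quadratic relation `(a₁b₂)(a₂b₁) = (a₁b₁)(a₂b₂)`. -/
def pencilMatrix : Matrix (Fin 4) (Fin 4) ℝ :=
  !![0, 0, 0, -1; 0, 0, 1, 0; 0, 1, 0, 0; -1, 0, 0, 0]

theorem pencilMatrix_isSymm : pencilMatrix.IsSymm := by
  ext i j
  fin_cases i <;> fin_cases j <;> rfl

theorem mulMap_pencilMatrix (hkm : k + m = d) (a₁ a₂ : binaryForms k) (b₁ b₂ : binaryForms m) :
    mulMap _ (gramTensor (prodFamily hkm a₁ a₂ b₁ b₂) pencilMatrix) = 0 := by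
  simp [mulMap_gramTensor, Fin.sum_univ_four, prodFamily, pencilMatrix, mulForm]
  ring

/-- The ten entries of a symmetric matrix fall on nine independent products; only `a₁a₂b₁b₂` is hit
twice, by the entries `(0,3)` and `(1,2)`, which must therefore cancel. -/
theorem SeparatedRoots.eq_smul_pencilMatrix (hkm : k + m = d) {a₁ a₂ : binaryForms k}
    {b₁ b₂ : binaryForms m} {s : Fin 3 → ℂ} (h : SeparatedRoots a₁ a₂ b₁ b₂ s)
    {c : Matrix (Fin 4) (Fin 4) ℝ} (hc : c.IsSymm)
    (h0 : mulMap _ (gramTensor (prodFamily hkm a₁ a₂ b₁ b₂) c) = 0) :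
    c = c 1 2 • pencilMatrix := by
  have h1 := dehom_mulMap_gramTensor (prodFamily hkm a₁ a₂ b₁ b₂) c
  rw [h0, map_zero] at h1
  have s10 : c 1 0 = c 0 1 := hc.apply _ _
  have s20 : c 2 0 = c 0 2 := hc.apply _ _
  have s30 : c 3 0 = c 0 3 := hc.apply _ _
  have s21 : c 2 1 = c 1 2 := hc.apply _ _
  have s31 : c 3 1 = c 1 3 := hc.apply _ _
  have s32 : c 3 2 = c 2 3 := hc.apply _ _
  simp only [Fin.sum_univ_four, prodFamily, s10, s20, s30, s21, s31, s32] at h1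
  simp only [Matrix.cons_val, dehom_mulForm] at h1
  -- Rows are indexed by `a₁², a₁a₂, a₂²` and columns by `b₁², b₁b₂, b₂²`.
  let e : Fin 3 → Fin 3 → ℝ := ![![c 0 0, 2 * c 0 1, c 1 1],
    ![2 * c 0 2, 2 * c 0 3 + 2 * c 1 2, 2 * c 1 3], ![c 2 2, 2 * c 2 3, c 3 3]]
  have he := h.products_linearIndependent e _ (fun _ => rfl) (by
    have hC : (C (2 : ℂ)) = 2 := map_ofNat C 2
    simp [e]
    rw [hC]
    linear_combination -h1)
  have e00 := he 0 0
  have e01 := he 0 1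
  have e02 := he 0 2
  have e10 := he 1 0
  have e11 := he 1 1
  have e12 := he 1 2
  have e20 := he 2 0
  have e21 := he 2 1
  have e22 := he 2 2
  simp [e] at e00 e01 e02 e10 e11 e12 e20 e21 e22
  have e11' : c 0 3 = -c 1 2 := by linarith
  ext i j
  fin_cases i <;> fin_cases j <;> simp [pencilMatrix, *]

/-- The pencil of tensors through the Gram tensors of two factorizations. -/
def pencil (u : Fin 4 → binaryForms d) (t : ℝ) : binaryForms d ⊗[ℝ] binaryForms d :=
  gramTensor u (1 + t • pencilMatrix)

theorem isPsd_pencil (u : Fin 4 → binaryForms d) {t : ℝ} (ht : |t| ≤ 1) :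
    IsPsd (pencil u t) := by
  obtain ⟨h1, h2⟩ := abs_le.1 ht
  refine isPsd_gramTensor u ?_ fun y => ?_
  · exact Matrix.IsSymm.add Matrix.isSymm_one (pencilMatrix_isSymm.smul t)
  · simp [Fin.sum_univ_four, pencilMatrix, Matrix.one_apply]
    -- The form equals `(1+t)/2 * ((y₀-y₃)² + (y₁+y₂)²) + (1-t)/2 * ((y₀+y₃)² + (y₁-y₂)²)`.
    nlinarith [mul_nonneg (sub_nonneg.2 h2) (sq_nonneg (y 0)),
      mul_nonneg (sub_nonneg.2 h2) (add_nonneg (sq_nonneg (y 0 + y 3)) (sq_nonneg (y 1 - y 2))),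
      mul_nonneg (neg_le_iff_add_nonneg.1 h1)
        (add_nonneg (sq_nonneg (y 0 - y 3)) (sq_nonneg (y 1 + y 2)))]

theorem abs_le_of_isPsd_pencil {u : Fin 4 → binaryForms d} (hu : LinearIndependent ℝ u) {t : ℝ}
    (h : IsPsd (pencil u t)) : |t| ≤ 1 := by
  -- The test vectors are eigenvectors of `pencilMatrix` for the eigenvalues `-1` and `1`.
  have h1 := h.nonneg_of_gramTensor hu ![1, 0, 0, 1]
  have h2 := h.nonneg_of_gramTensor hu ![1, 0, 0, -1]
  simp [Fin.sum_univ_four, pencilMatrix, Matrix.one_apply] at h1 h2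
  exact abs_le.2 ⟨by linarith, by linarith⟩

theorem mem_segment_pencil {u : Fin 4 → binaryForms d} {x : binaryForms d ⊗[ℝ] binaryForms d} :
    x ∈ segment ℝ (pencil u 1) (pencil u (-1)) ↔ ∃ t, |t| ≤ 1 ∧ x = pencil u t := by
  have key : ∀ a b : ℝ, a + b = 1 → a • pencil u 1 + b • pencil u (-1) = pencil u (a - b) := by
    intro a b hab
    rw [pencil, pencil, pencil, ← gramTensor_smul, ← gramTensor_smul, ← gramTensor_add]
    congr 1
    simp only [smul_add, smul_smul]
    rw [add_add_add_comm, ← add_smul, ← add_smul, hab, one_smul]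
    congr 2
    ring
  constructor
  · rintro ⟨a, b, ha, hb, hab, rfl⟩
    exact ⟨a - b, abs_le.2 ⟨by linarith, by linarith⟩, key a b hab⟩
  · rintro ⟨t, ht, rfl⟩
    obtain ⟨h1, h2⟩ := abs_le.1 ht
    refine ⟨(1 + t) / 2, (1 - t) / 2, by linarith, by linarith, by ring, ?_⟩
    rw [key _ _ (by ring)]
    congr 1
    ring

theorem mulMap_pencil (hkm : k + m = d) (a₁ a₂ : binaryForms k) (b₁ b₂ : binaryForms m) (t : ℝ) :
    mulMap _ (pencil (prodFamily hkm a₁ a₂ b₁ b₂) t) =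
      mulMap _ (gramTensor (prodFamily hkm a₁ a₂ b₁ b₂) 1) := by
  rw [pencil, gramTensor_add, gramTensor_smul, map_add, map_smul, mulMap_pencilMatrix, smul_zero,
    add_zero]

theorem pencil_mem_gramRel (hkm : k + m = d) {a₁ a₂ : binaryForms k} {b₁ b₂ : binaryForms m}
    {f : MvPolynomial (Fin 2) ℝ}
    (hf : pencil (prodFamily hkm a₁ a₂ b₁ b₂) 1 ∈ gramRel (binaryForms d) f) {t : ℝ}
    (ht : |t| ≤ 1) : pencil (prodFamily hkm a₁ a₂ b₁ b₂) t ∈ gramRel (binaryForms d) f :=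
  ⟨isPsd_pencil _ ht, by rw [mulMap_pencil, ← mulMap_pencil hkm _ _ _ _ 1]; exact hf.2⟩

theorem SeparatedRoots.comp {n n' : ℕ} {a₁ a₂ : binaryForms k} {b₁ b₂ : binaryForms m}
    {s : Fin n → ℂ} (h : SeparatedRoots a₁ a₂ b₁ b₂ s) {e : Fin n' → Fin n}
    (he : Function.Injective e) : SeparatedRoots a₁ a₂ b₁ b₂ (s ∘ e) :=
  ⟨fun _ => h.1 _, fun _ => h.2 _, fun _ _ hij => h.3 _ _ (he.ne hij)⟩

theorem SeparatedRoots.eq_pencil (hkm : k + m = d) {a₁ a₂ : binaryForms k} {b₁ b₂ : binaryForms m}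
    {s : Fin 3 → ℂ} (h : SeparatedRoots a₁ a₂ b₁ b₂ s) {c : Matrix (Fin 4) (Fin 4) ℝ}
    (hc : c.IsSymm) (h0 : mulMap _ (gramTensor (prodFamily hkm a₁ a₂ b₁ b₂) c) =
      mulMap _ (gramTensor (prodFamily hkm a₁ a₂ b₁ b₂) 1)) :
    ∃ t, gramTensor (prodFamily hkm a₁ a₂ b₁ b₂) c = pencil (prodFamily hkm a₁ a₂ b₁ b₂) t := by
  obtain ⟨e, rfl⟩ : ∃ e, c = 1 + e := ⟨c - 1, by abel⟩
  have he : e.IsSymm := by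
    have := hc.sub (Matrix.isSymm_one (n := Fin 4) (α := ℝ))
    rwa [add_sub_cancel_left] at this
  rw [gramTensor_add, map_add, add_eq_left] at h0
  exact ⟨e 1 2, by rw [pencil, ← h.eq_smul_pencilMatrix hkm he h0]⟩

/-- Three separated roots make the segment between the two Gram tensors a face. -/
theorem SeparatedRoots.isFace (hkm : k + m = d) {a₁ a₂ : binaryForms k} {b₁ b₂ : binaryForms m}
    {s : Fin 3 → ℂ} (h : SeparatedRoots a₁ a₂ b₁ b₂ s) {f : MvPolynomial (Fin 2) ℝ}
    (hf : pencil (prodFamily hkm a₁ a₂ b₁ b₂) 1 ∈ gramRel (binaryForms d) f) :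
    IsFace (gramRel (binaryForms d) f) (segment ℝ (pencil (prodFamily hkm a₁ a₂ b₁ b₂) 1)
      (pencil (prodFamily hkm a₁ a₂ b₁ b₂) (-1))) := by
  have hu := linearIndependent_prodFamily hkm
    (h.comp (e := Fin.castSucc) (Fin.castSucc_injective 2))
  refine ⟨convex_segment _ _, fun x hx => ?_, ?_⟩
  · obtain ⟨t, ht, rfl⟩ := mem_segment_pencil.1 hx
    exact pencil_mem_gramRel hkm hf ht
  · rintro x hx y hy z hz ⟨a, b, ha, hb, -, hxy⟩
    obtain ⟨t, ht, hzt⟩ := mem_segment_pencil.1 hz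
    -- Support confines `x` to the span of the products, uniqueness of the relation puts it on the
    -- pencil, and positivity then bounds the parameter.
    obtain ⟨c, hc, hxc⟩ := hx.1.exists_gramTensor_of_add hu hy.1 ha hb.le (hxy.trans hzt)
    obtain ⟨r, hr⟩ := h.eq_pencil hkm hc (by
      rw [← hxc, hx.2, ← hf.2, mulMap_pencil])
    rw [hr] at hxc
    rw [mem_segment_pencil]
    exact ⟨r, abs_le_of_isPsd_pencil hu (hxc ▸ hx.1), hxc⟩

end Pencil

/-! ### Pencils coming from factorizations `a b` and `a b̄`; the criterion for edges -/

section Factorization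

open Polynomial

variable {k m d : ℕ}

theorem smul_cplx (x y : ℝ) (p q : binaryForms d) :
    C (x + y * Complex.I : ℂ) * cplx p q = cplx (x • p - y • q) (y • p + x • q) := by
  simp only [cplx, Submodule.coe_sub, Submodule.coe_add, Submodule.coe_smul, map_sub, map_add,
    dehom_smul, C_mul]
  linear_combination (C (y : ℂ) * dehom q) * C_I_sq

/-- The psd tensor of a pair depends on the complex form only up to a unimodular factor. -/
theorem sqTensor_eq_of_cplx {p q p' q' : binaryForms d} {w : ℂ} (hw : ‖w‖ = 1)
    (h : cplx p' q' = C w * cplx p q) : sqTensor p' q' = sqTensor p q := by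
  rw [← Complex.re_add_im w, smul_cplx] at h
  obtain ⟨rfl, rfl⟩ := cplx_injective h
  refine sqTensor_rotate _ _ ?_
  rw [← Complex.sq_norm_sub_sq_re w, hw]
  ring

theorem sqTensor_eq_of_star {p q p' q' : binaryForms d}
    (h : cplx p' q' = (cplx p q).map (starRingEnd ℂ)) : sqTensor p' q' = sqTensor p q := by
  have h1 : cplx p' q' = cplx p (-q) := by
    rw [h, star_cplx, cplx, Submodule.coe_neg, map_neg]
    ring
  obtain ⟨rfl, rfl⟩ := cplx_injective h1
  exact sqTensor_neg_right _ _

theorem cplx_mul (hkm : k + m = d) (a₁ a₂ : binaryForms k) (b₁ b₂ : binaryForms m) :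
    cplx a₁ a₂ * cplx b₁ b₂ = cplx (mulForm hkm a₁ b₁ - mulForm hkm a₂ b₂)
      (mulForm hkm a₁ b₂ + mulForm hkm a₂ b₁) := by
  simp only [cplx, Submodule.coe_sub, Submodule.coe_add, map_sub, map_add, dehom_mulForm]
  linear_combination (dehom a₂ * dehom b₂) * C_I_sq

theorem cplx_mul_star' (hkm : k + m = d) (a₁ a₂ : binaryForms k) (b₁ b₂ : binaryForms m) :
    cplx a₁ a₂ * (cplx b₁ b₂).map (starRingEnd ℂ) =
      cplx (mulForm hkm a₁ b₁ + mulForm hkm a₂ b₂) (mulForm hkm a₂ b₁ - mulForm hkm a₁ b₂) := by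
  rw [star_cplx]
  simp only [cplx, Submodule.coe_sub, Submodule.coe_add, map_sub, map_add, dehom_mulForm]
  linear_combination (-dehom a₂ * dehom b₂) * C_I_sq

/-- For the product family, `u 0 - u 3` and `u 1 + u 2` are the real and imaginary parts of `a b`;
at `t = -1` the corresponding forms are those of `a b̄`. -/
theorem pencil_one (u : Fin 4 → binaryForms d) :
    pencil u 1 = sqTensor (u 0 - u 3) (u 1 + u 2) := by
  simp [pencil, gramTensor, sqTensor, Fin.sum_univ_four, pencilMatrix, Matrix.one_apply,
    TensorProduct.add_tmul, TensorProduct.tmul_add, TensorProduct.sub_tmul, TensorProduct.tmul_sub]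
  module

theorem pencil_neg_one (u : Fin 4 → binaryForms d) :
    pencil u (-1) = sqTensor (u 0 + u 3) (u 2 - u 1) := by
  simp [pencil, gramTensor, sqTensor, Fin.sum_univ_four, pencilMatrix, Matrix.one_apply,
    TensorProduct.add_tmul, TensorProduct.tmul_add, TensorProduct.sub_tmul, TensorProduct.tmul_sub]
  module

theorem sqTensor_eq_pencil_one (hkm : k + m = d) {a₁ a₂ : binaryForms k} {b₁ b₂ : binaryForms m}
    {p q : binaryForms d} {w : ℂ} (hw : ‖w‖ = 1)
    (h : cplx p q = C w * (cplx a₁ a₂ * cplx b₁ b₂)) :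
    sqTensor p q = pencil (prodFamily hkm a₁ a₂ b₁ b₂) 1 := by
  rw [cplx_mul hkm] at h
  rw [sqTensor_eq_of_cplx hw h, pencil_one]
  rfl

theorem sqTensor_eq_pencil_neg_one (hkm : k + m = d) {a₁ a₂ : binaryForms k}
    {b₁ b₂ : binaryForms m} {p q : binaryForms d} {w : ℂ} (hw : ‖w‖ = 1)
    (h : cplx p q = C w * (cplx a₁ a₂ * (cplx b₁ b₂).map (starRingEnd ℂ))) :
    sqTensor p q = pencil (prodFamily hkm a₁ a₂ b₁ b₂) (-1) := by
  rw [cplx_mul_star' hkm] at h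
  rw [sqTensor_eq_of_cplx hw h, pencil_neg_one]
  rfl

theorem SeparatedRoots.smul {n : ℕ} {a₁ a₂ a₁' a₂' : binaryForms k} {b₁ b₂ b₁' b₂' : binaryForms m}
    {s : Fin n → ℂ} (h : SeparatedRoots a₁ a₂ b₁ b₂ s) {v w : ℂ} (hv : v ≠ 0) (hw : w ≠ 0)
    (ha : cplx a₁' a₂' = C v * cplx a₁ a₂) (hb : cplx b₁' b₂' = C w * cplx b₁ b₂) :
    SeparatedRoots a₁' a₂' b₁' b₂' s := by
  have hv' : starRingEnd ℂ v ≠ 0 := (_root_.map_ne_zero _).2 hv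
  have hw' : starRingEnd ℂ w ≠ 0 := (_root_.map_ne_zero _).2 hw
  constructor
  · intro i
    rw [hb, eval_mul, h.eval_eq_zero, mul_zero]
  · intro i
    rw [hb, Polynomial.map_mul, eval_mul, map_C, eval_C]
    exact mul_ne_zero hw' (h.eval_star_ne_zero i)
  · intro i j hij h0
    apply h.separated i j hij
    rw [ha] at h0
    simp only [Polynomial.map_mul, eval_mul, map_C, eval_C] at h0
    apply mul_left_cancel₀ (mul_ne_zero hv hv')
    linear_combination h0

theorem SeparatedRoots.left_eq_zero {a₁ a₂ : binaryForms k} {b₁ b₂ : binaryForms m}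
    {s : Fin 2 → ℂ} (h : SeparatedRoots a₁ a₂ b₁ b₂ s) {x y : ℝ} (h0 : x • a₁ + y • a₂ = 0) :
    x = 0 ∧ y = 0 := by
  have h1 := congrArg (fun p : binaryForms k => dehom p) h0
  simp only [Submodule.coe_add, Submodule.coe_smul, map_add, dehom_smul, ZeroMemClass.coe_zero,
    map_zero] at h1
  have := binary_linear_eq_zero (α := x) (β := y) h.det_ne_zero (fun i => by
    simpa using congrArg (eval (s i)) h1)
  exact_mod_cast this

theorem SeparatedRoots.right_eq_zero {n : ℕ} {a₁ a₂ : binaryForms k} {b₁ b₂ : binaryForms m}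
    {s : Fin n → ℂ} (h : SeparatedRoots a₁ a₂ b₁ b₂ s) (i : Fin n) {x y : ℝ}
    (h0 : x • b₁ + y • b₂ = 0) : x = 0 ∧ y = 0 := by
  have h1 := congrArg (fun p : binaryForms m => (dehom p).eval (s i)) h0
  simp only [Submodule.coe_add, Submodule.coe_smul, map_add, dehom_smul, ZeroMemClass.coe_zero,
    map_zero, eval_add, eval_mul, eval_C, eval_zero, h.eval_left i] at h1
  have h2 : (y : ℂ) - Complex.I * x = 0 := by
    refine (mul_eq_zero.1 ?_).resolve_right (h.eval_right_ne_zero i)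
    linear_combination h1
  rw [Complex.ext_iff] at h2
  simp at h2
  exact ⟨h2.2, h2.1⟩

/-- The identity is interior to the psd cone: the form of `c` is bounded by the sum `S` of its
absolute entries times `∑ yᵢ²`, so `ε = 1/(1+S)` works. -/
theorem exists_pos_forall_quadratic_nonneg {ι : Type*} [Fintype ι] [DecidableEq ι]
    (c : Matrix ι ι ℝ) : ∃ ε : ℝ, 0 < ε ∧ ∀ r : ℝ, |r| ≤ ε → ∀ y : ι → ℝ,
      0 ≤ ∑ i, ∑ j, (1 + r • c) i j * y i * y j := by
  let S : ℝ := ∑ i, ∑ j, |c i j|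
  have hS : 0 ≤ S := Finset.sum_nonneg fun i _ => Finset.sum_nonneg fun j _ => abs_nonneg _
  have hbound : ∀ y : ι → ℝ, |∑ i, ∑ j, c i j * y i * y j| ≤ S * ∑ i, y i ^ 2 := by
    intro y
    rw [Finset.sum_mul]
    refine (Finset.abs_sum_le_sum_abs _ _).trans (Finset.sum_le_sum fun i _ => ?_)
    rw [Finset.sum_mul]
    refine (Finset.abs_sum_le_sum_abs _ _).trans (Finset.sum_le_sum fun j _ => ?_)
    rw [mul_assoc, abs_mul]
    refine mul_le_mul_of_nonneg_left ?_ (abs_nonneg _)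
    have hi : y i ^ 2 ≤ ∑ i, y i ^ 2 :=
      Finset.single_le_sum (f := fun i => y i ^ 2) (fun _ _ => sq_nonneg _) (Finset.mem_univ i)
    have hj : y j ^ 2 ≤ ∑ i, y i ^ 2 :=
      Finset.single_le_sum (f := fun i => y i ^ 2) (fun _ _ => sq_nonneg _) (Finset.mem_univ j)
    rw [abs_le]
    constructor <;> nlinarith [sq_nonneg (y i + y j), sq_nonneg (y i - y j)]
  have hεS : (1 + S)⁻¹ * S ≤ 1 := by
    rw [inv_mul_le_iff₀ (by linarith)]; linarith
  refine ⟨(1 + S)⁻¹, inv_pos.2 (by linarith), fun r hr y => ?_⟩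
  have h1 : ∑ i, ∑ j, (1 + r • c) i j * y i * y j =
      ∑ i, y i ^ 2 + r * ∑ i, ∑ j, c i j * y i * y j := by
    simp only [Matrix.add_apply, Matrix.smul_apply, smul_eq_mul, add_mul,
      Finset.sum_add_distrib, Finset.mul_sum, Matrix.one_apply, ite_mul, one_mul, zero_mul,
      Finset.sum_ite_eq, Finset.mem_univ, if_true, mul_assoc, sq]
  have hy : 0 ≤ ∑ i, y i ^ 2 := Finset.sum_nonneg fun i _ => sq_nonneg _
  have h2 : |r * ∑ i, ∑ j, c i j * y i * y j| ≤ (1 + S)⁻¹ * (S * ∑ i, y i ^ 2) := by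
    rw [abs_mul]
    exact mul_le_mul hr (hbound y) (abs_nonneg _) (inv_nonneg.2 (by linarith))
  rw [h1]
  have h3 := mul_le_mul_of_nonneg_right hεS hy
  rw [mul_assoc] at h3
  linarith [(abs_le.1 h2).1]

theorem pencil_zero_mem_openSegment (u : Fin 4 → binaryForms d) (c : Matrix (Fin 4) (Fin 4) ℝ)
    (r : ℝ) : pencil u 0 ∈ openSegment ℝ (gramTensor u (1 + r • c))
      (gramTensor u (1 + (-r) • c)) := by
  refine ⟨1 / 2, 1 / 2, by norm_num, by norm_num, by norm_num, ?_⟩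
  rw [pencil, ← gramTensor_smul, ← gramTensor_smul, ← gramTensor_add]
  congr 1
  ext i j
  simp only [Matrix.add_apply, Matrix.smul_apply, smul_eq_mul]
  ring

/-- A second relation among the products shows that the segment is not a face. -/
theorem not_isFace_of_relation {u : Fin 4 → binaryForms d} (hu : LinearIndependent ℝ u)
    {f : MvPolynomial (Fin 2) ℝ} (hf : mulMap _ (gramTensor u 1) = f)
    {c : Matrix (Fin 4) (Fin 4) ℝ} (hc : c.IsSymm) (hc0 : mulMap _ (gramTensor u c) = 0)
    (hne : ∀ t : ℝ, c ≠ t • pencilMatrix) :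
    ¬ IsFace (gramRel (binaryForms d) f) (segment ℝ (pencil u 1) (pencil u (-1))) := by
  intro hF
  obtain ⟨ε, hε, hpos⟩ := exists_pos_forall_quadratic_nonneg c
  have hmem : ∀ r : ℝ, |r| ≤ ε → gramTensor u (1 + r • c) ∈ gramRel (binaryForms d) f := by
    intro r hr
    refine ⟨isPsd_gramTensor u (Matrix.isSymm_one.add (hc.smul r)) (hpos r hr), ?_⟩
    rw [gramTensor_add, gramTensor_smul, map_add, map_smul, hc0, smul_zero, add_zero, hf]
  -- The midpoint has the identity as its matrix, so it can be moved by `±ε c` inside the Gram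
  -- spectrahedron; a face would have to contain the displaced points.
  have hmid : pencil u 0 ∈ segment ℝ (pencil u 1) (pencil u (-1)) :=
    mem_segment_pencil.2 ⟨0, by simp, rfl⟩
  have hx := hF.2.left_mem_of_mem_openSegment (hmem ε (abs_of_pos hε).le)
    (hmem (-ε) (by rw [abs_neg, abs_of_pos hε])) hmid (pencil_zero_mem_openSegment u c ε)
  obtain ⟨t, -, ht⟩ := mem_segment_pencil.1 hx
  have h2 : ε • c = t • pencilMatrix := add_left_cancel (gramTensor_injective hu ht)
  apply hne (ε⁻¹ * t)
  rw [mul_smul, ← h2, smul_smul, inv_mul_cancel₀ hε.ne', one_smul]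

/-- Two pairs of binary quadratic forms with a common element have an additional relation. -/
theorem exists_relation_of_common {a₁ a₂ b₁ b₂ : binaryForms 2} (hkm : 2 + 2 = d) {τ : ℝ}
    (hτ : τ ≠ 0) (h : a₁ = τ • b₁) :
    ∃ c : Matrix (Fin 4) (Fin 4) ℝ, c.IsSymm ∧
      mulMap _ (gramTensor (prodFamily hkm a₁ a₂ b₁ b₂) c) = 0 ∧
      ∀ t : ℝ, c ≠ t • pencilMatrix := by
  have hkm' : 2 + 2 = 4 := rfl
  -- All six products of `a₁, a₂, b₂` lie in the space of quartics, of dimension five.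
  let v : Fin 6 → binaryForms 4 := ![mulForm hkm' a₁ a₁, mulForm hkm' a₁ a₂, mulForm hkm' a₂ a₂,
    mulForm hkm' a₁ b₂, mulForm hkm' b₂ b₂, mulForm hkm' a₂ b₂]
  have hv : ¬ LinearIndependent ℝ v := by
    intro hv
    have := hv.fintype_card_le_finrank
    rw [finrank_binaryForms] at this
    simp at this
  rw [Fintype.not_linearIndependent_iff] at hv
  obtain ⟨κ, hκ, i, hi⟩ := hv
  have h0 := congrArg (fun p : binaryForms 4 => (p : MvPolynomial (Fin 2) ℝ)) hκ
  simp [v, Fin.sum_univ_six, mulForm] at h0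
  -- The relation is multiplied by `2 a₁²`; using `a₁ = τ b₁`, each term becomes a product of two
  -- members of the family.
  refine ⟨!![2 * τ ^ 2 * κ 0, τ * κ 3, τ ^ 2 * κ 1, τ * κ 5;
    τ * κ 3, 2 * κ 4, 0, 0; τ ^ 2 * κ 1, 0, 2 * τ ^ 2 * κ 2, 0; τ * κ 5, 0, 0, 0], ?_, ?_, ?_⟩
  · ext i j
    fin_cases i <;> fin_cases j <;> rfl
  · have ha : (a₁ : MvPolynomial (Fin 2) ℝ) =
        MvPolynomial.C τ * (b₁ : MvPolynomial (Fin 2) ℝ) := by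
      rw [h, Submodule.coe_smul, MvPolynomial.smul_eq_C_mul]
    simp [mulMap_gramTensor, Fin.sum_univ_four, prodFamily, mulForm]
    simp only [MvPolynomial.smul_eq_C_mul, map_mul, map_pow, map_ofNat, ha] at h0 ⊢
    linear_combination (2 * MvPolynomial.C τ ^ 2 * (b₁ : MvPolynomial (Fin 2) ℝ) ^ 2) * h0
  · intro t ht
    -- The entry `(1,2)` was arranged to be zero, so `t = 0` and every `κ` would vanish.
    have h12 := congrFun (congrFun ht 1) 2
    simp [pencilMatrix] at h12
    subst h12
    rw [zero_smul] at ht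
    have e00 := congrFun (congrFun ht 0) 0
    have e01 := congrFun (congrFun ht 0) 1
    have e02 := congrFun (congrFun ht 0) 2
    have e03 := congrFun (congrFun ht 0) 3
    have e11 := congrFun (congrFun ht 1) 1
    have e22 := congrFun (congrFun ht 2) 2
    simp [hτ] at e00 e01 e02 e03 e11 e22
    apply hi
    fin_cases i <;> assumption

/-- Pairs of binary quadratic forms can be rotated to have proportional first entries. -/
theorem SeparatedRoots.exists_rotation {a₁ a₂ b₁ b₂ : binaryForms 2} {s : Fin 2 → ℂ}
    (h : SeparatedRoots a₁ a₂ b₁ b₂ s) :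
    ∃ (a₁' a₂' b₁' b₂' : binaryForms 2) (v w : ℂ) (τ : ℝ), ‖v‖ = 1 ∧ ‖w‖ = 1 ∧ τ ≠ 0 ∧
      a₁' = τ • b₁' ∧ cplx a₁' a₂' = C v * cplx a₁ a₂ ∧ cplx b₁' b₂' = C w * cplx b₁ b₂ := by
  -- Four quadratic forms in a space of dimension three: the spans of the two pairs meet.
  have hdep : ¬ LinearIndependent ℝ ![a₁, a₂, b₁, b₂] := by
    intro hv
    have := hv.fintype_card_le_finrank
    rw [finrank_binaryForms] at this
    simp at this
  rw [Fintype.not_linearIndependent_iff] at hdep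
  obtain ⟨κ, hκ, i, hi⟩ := hdep
  simp [Fin.sum_univ_four] at hκ
  have hrot : ∀ x y : ℝ, ¬ (x = 0 ∧ y = 0) → ∃ (r : ℝ) (v : ℂ), r ≠ 0 ∧ ‖v‖ = 1 ∧
      ∀ p q : binaryForms 2, ∃ p' q' : binaryForms 2, cplx p' q' = C v * cplx p q ∧
        r • p' = x • p + y • q := by
    intro x y hxy
    -- The real part of `(x - i y)(p + i q)` is `x p + y q`, so the rotation is by `z / ‖z‖`.
    let z : ℂ := x - y * Complex.I
    have hz : z ≠ 0 := by
      intro hz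
      rw [Complex.ext_iff] at hz
      simp [z] at hz
      exact hxy hz
    refine ⟨‖z‖, ((x / ‖z‖ : ℝ) : ℂ) + ((-y / ‖z‖ : ℝ) : ℂ) * Complex.I, norm_ne_zero_iff.2 hz, ?_,
      fun p q => ⟨_, _, (smul_cplx _ _ _ _).symm, ?_⟩⟩
    · have : ((x / ‖z‖ : ℝ) : ℂ) + ((-y / ‖z‖ : ℝ) : ℂ) * Complex.I = z / ‖z‖ := by
        simp [z]; ring
      rw [this, norm_div, Complex.norm_real, norm_norm, div_self (norm_ne_zero_iff.2 hz)]
    · have : ‖z‖ ≠ 0 := norm_ne_zero_iff.2 hz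
      rw [smul_sub, smul_smul, smul_smul, mul_div_cancel₀ _ this, mul_div_cancel₀ _ this]
      module
  have hx : ¬ (κ 0 = 0 ∧ κ 1 = 0) := by
    rintro ⟨h0, h1⟩
    obtain ⟨h2, h3⟩ := h.right_eq_zero 0 (x := κ 2) (y := κ 3) (by simpa [h0, h1] using hκ)
    apply hi
    fin_cases i <;> assumption
  have hy : ¬ (-κ 2 = 0 ∧ -κ 3 = 0) := by
    rintro ⟨h2, h3⟩
    rw [neg_eq_zero] at h2 h3
    exact hx (h.left_eq_zero (by simpa [h2, h3] using hκ))
  obtain ⟨r, v, hr, hv, hv'⟩ := hrot _ _ hx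
  obtain ⟨t, w, ht, hw, hw'⟩ := hrot _ _ hy
  obtain ⟨a₁', a₂', ha, ha'⟩ := hv' a₁ a₂
  obtain ⟨b₁', b₂', hb, hb'⟩ := hw' b₁ b₂
  refine ⟨a₁', a₂', b₁', b₂', v, w, r⁻¹ * t, hv, hw, mul_ne_zero (inv_ne_zero hr) ht, ?_, ha, hb⟩
  have : r • a₁' = t • b₁' := by
    rw [ha', hb', ← sub_eq_zero, ← hκ]
    module
  rw [mul_smul, ← this, smul_smul, inv_mul_cancel₀ hr, one_smul]

theorem isFace_segment_of_factorization (hkm : k + m = d) {a₁ a₂ : binaryForms k}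
    {b₁ b₂ : binaryForms m} {p q p' q' : binaryForms d} {s : Fin 3 → ℂ}
    (h : SeparatedRoots a₁ a₂ b₁ b₂ s) (hpq : cplx p q = cplx a₁ a₂ * cplx b₁ b₂)
    (hpq' : cplx p' q' = cplx a₁ a₂ * (cplx b₁ b₂).map (starRingEnd ℂ))
    {f : MvPolynomial (Fin 2) ℝ} (hf : sqTensor p q ∈ gramRel (binaryForms d) f) :
    IsFace (gramRel (binaryForms d) f) (segment ℝ (sqTensor p q) (sqTensor p' q')) := by
  have h1 := sqTensor_eq_pencil_one hkm (a₁ := a₁) (a₂ := a₂) (b₁ := b₁) (b₂ := b₂) (w := 1)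
    (p := p) (q := q) (by simp) (by rw [hpq, C_1, one_mul])
  have h2 := sqTensor_eq_pencil_neg_one hkm (a₁ := a₁) (a₂ := a₂) (b₁ := b₁) (b₂ := b₂) (w := 1)
    (p := p') (q := q') (by simp) (by rw [hpq', C_1, one_mul])
  rw [h1] at hf ⊢
  rw [h2]
  exact h.isFace hkm hf

/-- Rotating `a` by `v` and `b` by `w` multiplies `a b` and `a b̄` by the unimodular constants `v w`
and `v w̄`; the tensors are unchanged, while the first entries become proportional. -/
theorem not_isFace_segment_of_factorization (hkm : 2 + 2 = d) {a₁ a₂ b₁ b₂ : binaryForms 2}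
    {p q p' q' : binaryForms d} {s : Fin 2 → ℂ}
    (h : SeparatedRoots a₁ a₂ b₁ b₂ s) (hpq : cplx p q = cplx a₁ a₂ * cplx b₁ b₂)
    (hpq' : cplx p' q' = cplx a₁ a₂ * (cplx b₁ b₂).map (starRingEnd ℂ))
    {f : MvPolynomial (Fin 2) ℝ} (hf : sqTensor p q ∈ gramRel (binaryForms d) f) :
    ¬ IsFace (gramRel (binaryForms d) f) (segment ℝ (sqTensor p q) (sqTensor p' q')) := by
  obtain ⟨a₁', a₂', b₁', b₂', v, w, τ, hv, hw, hτ, hab, ha, hb⟩ := h.exists_rotation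
  have hv0 : v ≠ 0 := norm_ne_zero_iff.1 (by rw [hv]; norm_num)
  have hw0 : w ≠ 0 := norm_ne_zero_iff.1 (by rw [hw]; norm_num)
  have hw0' : starRingEnd ℂ w ≠ 0 := (_root_.map_ne_zero _).2 hw0
  have h' := h.smul hv0 hw0 ha hb
  rw [sqTensor_eq_pencil_one hkm (a₁ := a₁') (a₂ := a₂') (b₁ := b₁') (b₂ := b₂')
    (w := (v * w)⁻¹) (by simp [hv, hw]) (by
      have : C (v * w)⁻¹ * (C v * C w) = 1 := by
        rw [← C_mul, ← C_mul, inv_mul_cancel₀ (mul_ne_zero hv0 hw0), C_1]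
      rw [hpq, ha, hb]
      linear_combination (-cplx a₁ a₂ * cplx b₁ b₂) * this)] at hf ⊢
  rw [sqTensor_eq_pencil_neg_one hkm (a₁ := a₁') (a₂ := a₂') (b₁ := b₁') (b₂ := b₂')
    (w := (v * starRingEnd ℂ w)⁻¹) (by simp [hv, hw]) (by
      have : C (v * starRingEnd ℂ w)⁻¹ * (C v * C (starRingEnd ℂ w)) = 1 := by
        rw [← C_mul, ← C_mul, inv_mul_cancel₀ (mul_ne_zero hv0 hw0'), C_1]
      rw [hpq', ha, hb, Polynomial.map_mul, map_C]
      linear_combination (-cplx a₁ a₂ * (cplx b₁ b₂).map (starRingEnd ℂ)) * this)]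
  obtain ⟨c, hc, hc0, hne⟩ := exists_relation_of_common (a₂ := a₂') (b₂ := b₂') hkm hτ hab
  exact not_isFace_of_relation (linearIndependent_prodFamily hkm h')
    (by rw [← hf.2, mulMap_pencil]) hc hc0 hne

end Factorization

/-! ### Generic root configurations -/

section Generic

open Polynomial

variable {σ : Type*}

/-- A configuration of points is generic if the points are distinct and two of them are separated
by every quotient of polynomials whose roots are further disjoint subsets of the points. -/
structure Generic (r : σ → ℂ) : Prop where
  injective : Function.Injective r
  separated : ∀ (A B : Finset σ) (i j : σ), B.Nonempty → Disjoint A B → i ≠ j → i ∉ A → i ∉ B →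
    j ∉ A → (∏ α ∈ A, (r i - r α)) * ∏ β ∈ B, (r j - r β) ≠
      (∏ α ∈ A, (r j - r α)) * ∏ β ∈ B, (r i - r β)

variable [Fintype σ]

/-- Genericity is implied by finitely many polynomial inequations, none of them trivial. -/
theorem exists_polynomial_generic : ∃ E : MvPolynomial σ ℂ, E ≠ 0 ∧
    ∀ r : σ → ℂ, MvPolynomial.eval r E ≠ 0 → Generic r := by
  classical
  let P (x : (Finset σ × Finset σ) × (σ × σ)) : MvPolynomial σ ℂ :=
    (∏ α ∈ x.1.1, (.X x.2.1 - .X α)) * ∏ β ∈ x.1.2, (.X x.2.2 - .X β) -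
      (∏ α ∈ x.1.1, (.X x.2.2 - .X α)) * ∏ β ∈ x.1.2, (.X x.2.1 - .X β)
  let D : Finset ((Finset σ × Finset σ) × (σ × σ)) := Finset.univ.filter fun x =>
    x.1.2.Nonempty ∧ Disjoint x.1.1 x.1.2 ∧ x.2.1 ≠ x.2.2 ∧ x.2.1 ∉ x.1.1 ∧ x.2.1 ∉ x.1.2 ∧
      x.2.2 ∉ x.1.1
  refine ⟨(∏ x ∈ D, P x) * ∏ x : σ × σ with x.1 ≠ x.2, (.X x.1 - .X x.2), ?_, ?_⟩
  · refine mul_ne_zero (Finset.prod_ne_zero_iff.2 ?_) (Finset.prod_ne_zero_iff.2 ?_)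
    · rintro ⟨⟨A, B⟩, i, j⟩ hx h0
      obtain ⟨⟨b, hb⟩, hAB, hij, hiA, hiB, hjA⟩ := (Finset.mem_filter.1 hx).2
      dsimp only at hb hAB hij hiA hiB hjA
      -- At this point the second product is `0` and the fourth is `1`, so the difference is `-1`.
      -- The index `j` may lie in `B`; its value is `1` in either case.
      let v : σ → ℂ := fun s => if s ∈ A then 0 else if s = i then 2 else 1
      have hv := congrArg (MvPolynomial.eval v) h0
      simp only [P, map_sub, map_mul, map_prod, MvPolynomial.eval_X, map_zero] at hv
      have hvA : ∀ s ∈ A, v s = 0 := fun s hs => if_pos hs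
      have hvB : ∀ s ∈ B, v s = 1 := fun s hs => by
        simp only [v]
        rw [if_neg (Finset.disjoint_right.1 hAB hs), if_neg (ne_of_mem_of_not_mem hs hiB)]
      have hvi : v i = 2 := by simp [v, hiA]
      have hvj : v j = 1 := by simp [v, hjA, hij.symm]
      have e1 : ∏ s ∈ A, (v j - v s) = 1 :=
        Finset.prod_eq_one fun s hs => by rw [hvA s hs, hvj, sub_zero]
      have e2 : ∏ s ∈ B, (v i - v s) = 1 :=
        Finset.prod_eq_one fun s hs => by rw [hvB s hs, hvi]; norm_num
      rw [Finset.prod_eq_zero (s := B) hb (by rw [hvj, hvB b hb, sub_self]), e1, e2] at hv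
      norm_num at hv
    · rintro ⟨i, j⟩ hx h0
      have hij : i ≠ j := (Finset.mem_filter.1 hx).2
      exact hij (MvPolynomial.X_injective (sub_eq_zero.1 h0))
  · intro r hr
    rw [map_mul, map_prod, map_prod] at hr
    have h1 := Finset.prod_ne_zero_iff.1 (left_ne_zero_of_mul hr)
    have h2 := Finset.prod_ne_zero_iff.1 (right_ne_zero_of_mul hr)
    constructor
    · intro i j hij
      by_contra hne
      apply h2 (i, j) (by simpa using hne)
      simp [hij]
    · intro A B i j hB hAB hij hiA hiB hjA h0
      apply h1 ((A, B), (i, j)) (by simp [D, hB, hAB, hij, hiA, hiB, hjA])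
      simp only [P, map_sub, map_mul, map_prod, MvPolynomial.eval_X]
      exact sub_eq_zero.2 h0

/-- Genericity can be ensured by a polynomial in the elementary symmetric functions. -/
theorem exists_symmetric_generic {n : ℕ} (hn : Fintype.card σ = n) :
    ∃ (S : MvPolynomial σ ℂ) (T : MvPolynomial (Fin n) ℂ), S ≠ 0 ∧
      (∀ r : σ → ℂ, MvPolynomial.eval r S =
        MvPolynomial.eval (fun i : Fin n => (Finset.univ.val.map r).esymm (i + 1)) T) ∧
      ∀ r : σ → ℂ, MvPolynomial.eval r S ≠ 0 → Generic r := by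
  classical
  obtain ⟨E, hE, hgen⟩ := exists_polynomial_generic (σ := σ)
  -- The product over all permutations is symmetric, and the factor of the identity is `E` itself.
  let S : MvPolynomial σ ℂ := ∏ τ : Equiv.Perm σ, MvPolynomial.rename τ E
  have hS : S.IsSymmetric := by
    intro τ
    rw [map_prod]
    refine Fintype.prod_equiv (Equiv.mulLeft τ) _ _ fun ρ => ?_
    rw [MvPolynomial.rename_rename]
    rfl
  obtain ⟨T, hT⟩ := MvPolynomial.esymmAlgHom_surjective (σ := σ) ℂ hn.le ⟨S, hS⟩
  refine ⟨S, T, ?_, ?_, ?_⟩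
  · refine Finset.prod_ne_zero_iff.2 fun τ _ h0 => hE ?_
    exact MvPolynomial.rename_injective _ τ.injective (by rw [h0, map_zero])
  · intro r
    have h1 := congrArg Subtype.val hT
    rw [MvPolynomial.esymmAlgHom_apply] at h1
    replace h1 : MvPolynomial.aeval _ T = S := h1
    rw [← MvPolynomial.coe_aeval_eq_eval, ← MvPolynomial.coe_aeval_eq_eval]
    change MvPolynomial.aeval r S = MvPolynomial.aeval _ T
    rw [← h1, ← AlgHom.comp_apply, MvPolynomial.comp_aeval]
    simp only [MvPolynomial.aeval_esymm_eq_multiset_esymm]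
  · intro r hr
    apply hgen
    rw [map_prod] at hr
    have := Finset.prod_ne_zero_iff.1 hr 1 (Finset.mem_univ _)
    simpa using this

variable {d : ℕ}

/-- The points `z j` and their complex conjugates. -/
def rootPair (z : Fin d → ℂ) (s : Fin d × Bool) : ℂ :=
  if s.2 then z s.1 else starRingEnd ℂ (z s.1)

theorem rootPair_not (z : Fin d → ℂ) (j : Fin d) (b : Bool) :
    rootPair z (j, !b) = starRingEnd ℂ (rootPair z (j, b)) := by
  cases b <;> simp [rootPair]

/-- A nonzero polynomial does not vanish at all conjugation-invariant configurations. -/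
theorem exists_eval_rootPair_ne_zero {S : MvPolynomial (Fin d × Bool) ℂ} (hS : S ≠ 0) :
    ∃ z : Fin d → ℂ, MvPolynomial.eval (rootPair z) S ≠ 0 := by
  by_contra! hcon
  apply hS
  -- An invertible linear change of variables under which real points become conjugation-invariant
  -- configurations; a polynomial vanishing at all real points is zero.
  let φ : Fin d × Bool → MvPolynomial (Fin d × Bool) ℂ := fun s =>
    if s.2 then .X (s.1, true) + .C Complex.I * .X (s.1, false)
    else .X (s.1, true) - .C Complex.I * .X (s.1, false)
  have heval : ∀ x : Fin d × Bool → ℂ, MvPolynomial.eval x (MvPolynomial.bind₁ φ S) =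
      MvPolynomial.eval (fun s => if s.2 then x (s.1, true) + Complex.I * x (s.1, false)
        else x (s.1, true) - Complex.I * x (s.1, false)) S := by
    intro x
    rw [← MvPolynomial.coe_aeval_eq_eval, ← MvPolynomial.coe_aeval_eq_eval]
    refine (MvPolynomial.aeval_bind₁ _ _ _).trans ?_
    change MvPolynomial.aeval _ S = MvPolynomial.aeval _ S
    congr 2
    funext s
    rcases s with ⟨j, b⟩
    cases b <;> simp [φ]
  have h0 : MvPolynomial.bind₁ φ S = 0 := by
    refine MvPolynomial.funext_set (fun _ => Set.range ((↑) : ℝ → ℂ))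
      (fun _ => Set.infinite_range_of_injective Complex.ofReal_injective) fun x hx => ?_
    choose y hy using fun s => hx s (Set.mem_univ s)
    rw [heval, map_zero, ← hcon fun j => y (j, true) + Complex.I * y (j, false)]
    congr 2
    funext s
    rcases s with ⟨j, b⟩
    cases b <;> simp [rootPair, ← hy, sub_eq_add_neg]
  refine MvPolynomial.funext fun x => ?_
  rw [map_zero]
  let y : Fin d × Bool → ℂ := fun s => if s.2 then (x (s.1, true) + x (s.1, false)) / 2
    else (x (s.1, true) - x (s.1, false)) / (2 * Complex.I)
  have := heval y
  rw [h0, map_zero] at this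
  rw [this]
  congr 2
  funext s
  rcases s with ⟨j, b⟩
  have hI := Complex.I_ne_zero
  cases b <;> simp [y] <;> field_simp <;> ring

/-- The normalized coefficients of a form, up to sign the elementary symmetric functions of its
roots. -/
def rootSymm {n : ℕ} (f : binaryForms n) (i : Fin n) : ℂ :=
  (-1) ^ (i.val + 1) * ((dehom f).coeff (n - (i + 1)) / (dehom f).coeff n)

/-- Vieta's formulas. -/
theorem rootSymm_eq {n : ℕ} (hn : Fintype.card σ = n) {f : binaryForms n} {c : ℂ} (hc : c ≠ 0)
    {r : σ → ℂ} (h : dehom f = C c * ∏ s, (X - C (r s))) (i : Fin n) :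
    rootSymm f i = (Finset.univ.val.map r).esymm (i + 1) := by
  have hcard : Multiset.card (Finset.univ.val.map r) = n := by simpa using hn
  have hcoeff : ∀ k ≤ n, (dehom f).coeff k =
      c * ((-1) ^ (n - k) * (Finset.univ.val.map r).esymm (n - k)) := by
    intro k hk
    have := Multiset.prod_X_sub_C_coeff (Finset.univ.val.map r) (k := k) (by rwa [hcard])
    rw [Multiset.map_map, hcard] at this
    rw [h, coeff_C_mul, ← this]
    rfl
  rw [rootSymm, hcoeff _ (Nat.sub_le _ _), hcoeff n le_rfl, Nat.sub_self,
    Nat.sub_sub_self (Nat.succ_le_of_lt i.2)]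
  simp only [pow_zero, Multiset.esymm, Multiset.powersetCard_zero_left, Multiset.map_singleton,
    Multiset.prod_zero, Multiset.sum_singleton, mul_one]
  rw [mul_div_cancel_left₀ _ hc, ← mul_assoc, ← mul_pow]
  simp

/-! ### Sums of squares -/

theorem sosCone_add {f g : binaryForms (2 * d)} (hf : f ∈ sosCone d) (hg : g ∈ sosCone d) :
    f + g ∈ sosCone d := by
  obtain ⟨r, p, hp⟩ := hf
  obtain ⟨s, q, hq⟩ := hg
  refine ⟨r + s, Fin.append p q, ?_⟩
  rw [Fin.sum_univ_add]
  simp [hp, hq]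

theorem sosCone_smul {f : binaryForms (2 * d)} (hf : f ∈ sosCone d) {t : ℝ} (ht : 0 ≤ t) :
    t • f ∈ sosCone d := by
  obtain ⟨r, p, hp⟩ := hf
  refine ⟨r, fun i => √t • p i, ?_⟩
  simp [hp, Finset.smul_sum, _root_.smul_pow, Real.sq_sqrt ht]

/-- The form `p² + q²`. -/
def sqForm (p q : binaryForms d) : binaryForms (2 * d) :=
  mulForm (two_mul d).symm p p + mulForm (two_mul d).symm q q

theorem coe_sqForm (p q : binaryForms d) :
    (sqForm p q : MvPolynomial (Fin 2) ℝ) = (p : MvPolynomial (Fin 2) ℝ) * p + q * q := rfl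

theorem sqForm_mem_sosCone (p q : binaryForms d) : sqForm p q ∈ sosCone d :=
  ⟨2, ![p, q], by simp [coe_sqForm, sq]⟩

theorem dehom_sqForm (p q : binaryForms d) :
    dehom (sqForm p q) = cplx p q * (cplx p q).map (starRingEnd ℂ) := by
  rw [cplx_mul_star, coe_sqForm, map_add, map_mul, map_mul, sq, sq]

theorem prod_rootPair (z : Fin d → ℂ) : (∏ j, (X - C (z j))) *
    (∏ j, (X - C (z j))).map (starRingEnd ℂ) = ∏ s, (X - C (rootPair z s)) := by
  rw [Fintype.prod_prod_type, Polynomial.map_prod, ← Finset.prod_mul_distrib]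
  simp [rootPair]

theorem coeff_dehom_mem_real (p : MvPolynomial (Fin 2) ℝ) (i : ℕ) :
    (dehom p).coeff i = (((dehom p).coeff i).re : ℂ) := by
  rw [dehom_apply, coeff_map]
  rfl

theorem coeff_nonneg_of_mem_sosCone {f : binaryForms (2 * d)} (hf : f ∈ sosCone d) :
    0 ≤ ((dehom f).coeff (2 * d)).re := by
  obtain ⟨r, p, hp⟩ := hf
  rw [hp, map_sum, finsetSum_coeff, Complex.re_sum]
  refine Finset.sum_nonneg fun i _ => ?_
  rw [map_pow, sq, two_mul, coeff_mul_add_eq_of_natDegree_le (natDegree_dehom_le _)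
    (natDegree_dehom_le _), coeff_dehom_mem_real, ← Complex.ofReal_mul, Complex.ofReal_re]
  exact mul_self_nonneg _

/-- A sum of squares with distinct roots has no real roots. -/
theorem im_ne_zero_of_mem_sosCone {f : binaryForms (2 * d)} (hf : f ∈ sosCone d)
    (h0 : dehom f ≠ 0) (hnodup : (dehom f).roots.Nodup) {x : ℂ} (hx : (dehom f).IsRoot x) :
    x.im ≠ 0 := by
  intro him
  obtain ⟨r, p, hp⟩ := hf
  have hreal : x = (x.re : ℂ) := (Complex.conj_eq_iff_re.1 (Complex.conj_eq_iff_im.2 him)).symm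
  have hval : ∀ i, (dehom (p i)).eval x =
      (((MvPolynomial.aeval ![(X : ℝ[X]), 1] (p i : MvPolynomial (Fin 2) ℝ)).eval x.re : ℝ) : ℂ) := by
    intro i
    conv_lhs => rw [hreal]
    rw [dehom_apply]
    rw [eval_map_algebraMap]
    exact aeval_algebraMap_apply_eq_algebraMap_eval _ _
  have hsum : ∑ i, ((MvPolynomial.aeval ![(X : ℝ[X]), 1]
      (p i : MvPolynomial (Fin 2) ℝ)).eval x.re) ^ 2 = 0 := by
    have := hx
    rw [IsRoot, hp, map_sum, eval_finsetSum] at this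
    simp only [map_pow, eval_pow, hval] at this
    exact_mod_cast this
  rw [Finset.sum_eq_zero_iff_of_nonneg fun _ _ => sq_nonneg _] at hsum
  -- At a real root every summand `p i ^ 2` vanishes, so the root is double.
  have hdvd : (X - C x) ^ 2 ∣ dehom f := by
    rw [hp, map_sum]
    refine Finset.dvd_sum fun i _ => ?_
    rw [map_pow]
    refine pow_dvd_pow_of_dvd (dvd_iff_isRoot.2 ?_) 2
    rw [IsRoot, hval, pow_eq_zero_iff two_ne_zero |>.1 (hsum i (Finset.mem_univ i))]
    simp
  have h2 := (le_rootMultiplicity_iff h0).2 hdvd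
  rw [← count_roots] at h2
  have := Multiset.nodup_iff_count_le_one.1 hnodup x
  omega

end Generic

/-! ### Openness and density of the sums of squares with generic roots -/

section OpenDense

open Polynomial Filter Topology

variable {d : ℕ}

/-- Coefficients of dehomogenized forms as linear maps. -/
def dehomCoeff (n i : ℕ) : binaryForms n →ₗ[ℝ] ℂ where
  toFun f := (dehom f).coeff i
  map_add' f g := by simp
  map_smul' t f := by simp

theorem eq_prod_of_splits {σ : Type*} [Fintype σ] {n : ℕ} (hn : Fintype.card σ = n)
    {F : ℂ[X]} (hdeg : F.natDegree ≤ n) (h0 : F.coeff n ≠ 0) :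
    ∃ r : σ → ℂ, F = C (F.coeff n) * ∏ s, (X - C (r s)) ∧ F.roots = Finset.univ.val.map r := by
  have hd : F.natDegree = n := le_antisymm hdeg (le_natDegree_of_ne_zero h0)
  have hs : F.Splits := IsAlgClosed.splits F
  have hcard : Fintype.card σ = F.roots.toList.length := by
    rw [Multiset.length_toList, ← hs.natDegree_eq_card_roots, hd, hn]
  let e : σ ≃ Fin F.roots.toList.length := Fintype.equivFinOfCardEq hcard
  have hr : F.roots = Finset.univ.val.map fun s => F.roots.toList.get (e s) := by
    have h1 : (Finset.univ : Finset (Fin F.roots.toList.length)).val.map F.roots.toList.get =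
        F.roots := by
      rw [Fin.univ_val_map, List.ofFn_get, Multiset.coe_toList]
    conv_lhs => rw [← h1, ← Finset.map_univ_equiv e, Finset.map_val, Multiset.map_map]
    rfl
  refine ⟨_, ?_, hr⟩
  conv_lhs => rw [hs.eq_prod_roots, hr, Multiset.map_map]
  rw [leadingCoeff, hd]
  rfl

/-- A sum of squares all of whose root configurations are generic has roots `z j` and their
conjugates. -/
theorem exists_rootPair {f : binaryForms (2 * d)} (hf : f ∈ sosCone d)
    (h0 : (dehom f).coeff (2 * d) ≠ 0)
    (hgen : ∀ r : Fin d × Bool → ℂ,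
      dehom f = C ((dehom f).coeff (2 * d)) * ∏ s, (X - C (r s)) → Generic r) :
    ∃ (z : Fin d → ℂ) (c : ℝ), 0 < c ∧ dehom f = C (c : ℂ) * ∏ s, (X - C (rootPair z s)) ∧
      Generic (rootPair z) := by
  classical
  have hcard : Fintype.card (Fin d × Bool) = 2 * d := by simp [mul_comm]
  obtain ⟨r, hr, hroots⟩ := eq_prod_of_splits hcard (natDegree_dehom_le f) h0
  have hrinj := (hgen r hr).injective
  have hF0 : dehom f ≠ 0 := fun h => h0 (by rw [h, coeff_zero])
  have hnodup : (dehom f).roots.Nodup := by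
    rw [hroots]
    exact Finset.univ.nodup.map hrinj
  have him : ∀ s, (r s).im ≠ 0 := fun s =>
    im_ne_zero_of_mem_sosCone hf hF0 hnodup (isRoot_of_mem_roots (by
      rw [hroots]; exact Multiset.mem_map_of_mem _ (Finset.mem_univ_val s)))
  have hconj : ∀ s, ∃ t, r t = starRingEnd ℂ (r s) := by
    intro s
    have hs : (dehom f).eval (r s) = 0 := by
      rw [hr, eval_mul, eval_prod, Finset.prod_eq_zero (Finset.mem_univ s) (by simp), mul_zero]
    have ht : starRingEnd ℂ (r s) ∈ (dehom f).roots := by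
      rw [mem_roots hF0, IsRoot, ← star_dehom, eval_map, eval₂_hom, hs, map_zero]
    rw [hroots] at ht
    obtain ⟨t, -, ht⟩ := Multiset.mem_map.1 ht
    exact ⟨t, ht⟩
  choose τ hτ using hconj
  let P : Finset (Fin d × Bool) := Finset.univ.filter fun s => 0 < (r s).im
  have hP : P.card = d := by
    -- Conjugation exchanges the roots in the upper half plane with the others, since no root is
    -- real.
    have h1 : P.card = Pᶜ.card := by
      refine Finset.card_bij' (fun s _ => τ s) (fun s _ => τ s) ?_ ?_ ?_ ?_
      · intro s hs
        have := (Finset.mem_filter.1 hs).2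
        simp only [P, Finset.mem_compl, Finset.mem_filter, Finset.mem_univ, true_and, hτ,
          Complex.conj_im]
        linarith
      · intro s hs
        have h1 : ¬ 0 < (r s).im := by simpa [P] using hs
        have h2 := him s
        simp only [P, Finset.mem_filter, Finset.mem_univ, true_and, hτ, Complex.conj_im]
        exact neg_pos.2 (lt_of_le_of_ne (not_lt.1 h1) h2)
      · intro s _
        exact hrinj (by rw [hτ, hτ, Complex.conj_conj])
      · intro s _
        exact hrinj (by rw [hτ, hτ, Complex.conj_conj])
    have h2 := Finset.card_add_card_compl P
    rw [hcard] at h2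
    omega
  let e : Fin d ≃ P := (Finset.equivFinOfCardEq hP).symm
  let z : Fin d → ℂ := fun j => r (e j)
  have hz : ∀ j, 0 < (z j).im := fun j => (Finset.mem_filter.1 (e j).2).2
  have hzinj : Function.Injective (rootPair z) := by
    rintro ⟨i, b⟩ ⟨j, b'⟩ hij
    have hzz : ∀ i j, z i = z j → i = j := fun i j h =>
      e.injective (Subtype.ext (hrinj h))
    have hne : ∀ i j, z i ≠ starRingEnd ℂ (z j) := by
      intro i j h
      have := congrArg Complex.im h
      rw [Complex.conj_im] at this
      linarith [hz i, hz j]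
    cases b <;> cases b' <;> simp only [rootPair, if_true, Bool.false_eq_true, if_false] at hij
    · rw [hzz i j ((starRingEnd ℂ).injective hij)]
    · exact absurd hij.symm (hne j i)
    · exact absurd hij (hne i j)
    · rw [hzz i j hij]
  have hmem : ∀ s, ∃ t, r t = rootPair z s := by
    rintro ⟨j, b⟩
    cases b
    · exact ⟨τ (e j), by simp [hτ, rootPair, z]⟩
    · exact ⟨e j, by simp [rootPair, z]⟩
  choose ρ hρ using hmem
  have hρinj : Function.Injective ρ := fun s t h => hzinj (by rw [← hρ, ← hρ, h])
  have hprod : ∏ s, (X - C (r s)) = ∏ s, (X - C (rootPair z s)) := by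
    rw [← Equiv.prod_comp (Equiv.ofBijective ρ (Finite.injective_iff_bijective.1 hρinj))]
    exact Finset.prod_congr rfl fun s _ => by rw [← hρ]; rfl
  have hreal := coeff_dehom_mem_real f (2 * d)
  rw [hprod] at hr
  refine ⟨z, ((dehom f).coeff (2 * d)).re, ?_, by rw [← hreal]; exact hr, hgen _ hr⟩
  refine lt_of_le_of_ne (coeff_nonneg_of_mem_sosCone hf) fun h => h0 ?_
  rw [hreal, ← h, Complex.ofReal_zero]

theorem exists_mem_sosCone_rootPair (z : Fin d → ℂ) : ∃ f ∈ sosCone d,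
    dehom f = ∏ s, (X - C (rootPair z s)) := by
  have hdeg : (∏ j, (X - C (z j))).natDegree ≤ d := by
    rw [natDegree_prod_of_monic _ _ fun j _ => monic_X_sub_C _]
    simp
  obtain ⟨p, q, hpq⟩ := exists_cplx hdeg
  exact ⟨sqForm p q, sqForm_mem_sosCone p q, by rw [dehom_sqForm, hpq, prod_rootPair]⟩

theorem mem_closure_of_line {E : Type*} [AddCommGroup E] [Module ℝ E] [TopologicalSpace E]
    [ContinuousAdd E] [ContinuousSMul ℝ E] {U : Set E} {x y : E}
    (h : ∀ᶠ t : ℝ in 𝓝[>] 0, x + t • y ∈ U) : x ∈ closure U := by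
  have hc : Tendsto (fun t : ℝ => x + t • y) (𝓝[>] 0) (𝓝 x) := by
    have : Continuous fun t : ℝ => x + t • y := by fun_prop
    have h1 := this.tendsto 0
    simp only [zero_smul, add_zero] at h1
    exact h1.mono_left nhdsWithin_le_nhds
  exact mem_closure_of_tendsto hc h

theorem eventually_ne_zero_of_finite {p : ℝ → Prop} (h : {t | ¬ p t}.Finite) :
    ∀ᶠ t : ℝ in 𝓝[>] 0, p t :=
  nhdsWithin_mono _ (fun _ ht => ne_of_gt ht)
    (nhdsNE_le_cofinite (a := (0 : ℝ)) (mem_cofinite.2 h))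

/-- There is an open dense set of sums of squares with generic roots. -/
theorem exists_isOpenDenseIn_generic (d : ℕ) : ∃ U : Set (binaryForms (2 * d)),
    IsOpenDenseIn U (sosCone d) ∧ ∀ f ∈ U, ∃ (z : Fin d → ℂ) (c : ℝ), 0 < c ∧
      dehom f = C (c : ℂ) * ∏ s, (X - C (rootPair z s)) ∧ Generic (rootPair z) := by
  have hcard : Fintype.card (Fin d × Bool) = 2 * d := by simp [mul_comm]
  obtain ⟨S, T, hS, hST, hgen⟩ := exists_symmetric_generic hcard
  let O : Set (binaryForms (2 * d)) := {f | (dehom f).coeff (2 * d) ≠ 0 ∧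
    MvPolynomial.eval (rootSymm f) T ≠ 0}
  refine ⟨sosCone d ∩ O, ?_, ?_⟩
  · let _ : TopologicalSpace (binaryForms (2 * d)) := moduleTopology ℝ _
    have : IsModuleTopology ℝ (binaryForms (2 * d)) := ⟨rfl⟩
    have : ContinuousAdd (binaryForms (2 * d)) := ModuleTopology.continuousAdd ℝ _
    have : ContinuousSMul ℝ (binaryForms (2 * d)) := ModuleTopology.continuousSMul ℝ _
    have hcont : ∀ i, Continuous fun f : binaryForms (2 * d) => (dehom f).coeff i := fun i =>
      IsModuleTopology.continuous_of_linearMap (dehomCoeff (2 * d) i)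
    have hO : IsOpen O := by
      have h1 : IsOpen {f : binaryForms (2 * d) | (dehom f).coeff (2 * d) ≠ 0} :=
        isOpen_ne_fun (hcont _) continuous_const
      have h2 : ContinuousOn (fun f => MvPolynomial.eval (rootSymm f) T)
          {f : binaryForms (2 * d) | (dehom f).coeff (2 * d) ≠ 0} := by
        refine (MvPolynomial.continuous_eval T).comp_continuousOn (continuousOn_pi.2 fun i => ?_)
        exact continuousOn_const.mul ((hcont _).continuousOn.div (hcont _).continuousOn
          fun f hf => hf)
      exact h2.isOpen_inter_preimage h1 isOpen_ne
    refine ⟨⟨O, hO, rfl⟩, ?_⟩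
    -- A single generic monic sum of squares `f₁` serves as the direction of all perturbations.
    obtain ⟨z, hz⟩ := exists_eval_rootPair_ne_zero hS
    obtain ⟨f₁, hf₁, hz₁⟩ := exists_mem_sosCone_rootPair z
    have hlead : (dehom f₁).coeff (2 * d) = 1 := by
      have hm : (∏ s, (X - C (rootPair z s))).Monic := monic_prod_of_monic _ _ fun _ _ =>
        monic_X_sub_C _
      have hdeg : (∏ s, (X - C (rootPair z s))).natDegree = 2 * d := by
        rw [natDegree_prod_of_monic _ _ fun j _ => monic_X_sub_C _]
        simp [mul_comm]
      rw [hz₁, ← hdeg]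
      exact hm
    have hsymm₁ : MvPolynomial.eval (rootSymm f₁) T ≠ 0 := by
      have : rootSymm f₁ = fun i : Fin (2 * d) =>
          (Finset.univ.val.map (rootPair z)).esymm (i + 1) :=
        funext fun i => rootSymm_eq hcard one_ne_zero (by rw [C_1, one_mul]; exact hz₁) i
      rw [this, ← hST]
      exact hz
    have step₁ : sosCone d ⊆
        closure {f | f ∈ sosCone d ∧ (dehom f).coeff (2 * d) ≠ 0} := by
      intro f hf
      refine mem_closure_of_line (y := f₁) ?_
      have hfin : {t : ℝ | ¬ (dehom ((f + t • f₁ : binaryForms (2 * d)) :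
          MvPolynomial (Fin 2) ℝ)).coeff (2 * d) ≠ 0}.Finite := by
        refine Set.Subsingleton.finite fun t ht u hu => ?_
        simp only [ne_eq, not_not, Set.mem_ofPred_eq, Submodule.coe_add, Submodule.coe_smul,
          map_add, dehom_smul, coeff_add, coeff_C_mul, hlead, mul_one] at ht hu
        exact_mod_cast add_left_cancel (ht.trans hu.symm)
      filter_upwards [eventually_ne_zero_of_finite hfin, self_mem_nhdsWithin] with t ht htpos
      exact ⟨sosCone_add hf (sosCone_smul hf₁ (le_of_lt htpos)), ht⟩
    have step₂ : {f | f ∈ sosCone d ∧ (dehom f).coeff (2 * d) ≠ 0} ⊆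
        closure (sosCone d ∩ O) := by
      rintro f ⟨hf, hf0⟩
      let c : ℝ := ((dehom f).coeff (2 * d)).re
      have hc : (dehom f).coeff (2 * d) = (c : ℂ) := coeff_dehom_mem_real _ _
      have hc0 : 0 ≤ c := coeff_nonneg_of_mem_sosCone hf
      have hcne : (c : ℂ) ≠ 0 := hc ▸ hf0
      -- Moving towards `c • f₁`, which has the leading coefficient of `f`, keeps that coefficient
      -- fixed. So `rootSymm` is affine in `t` and `T` restricts to a polynomial `Q`, nonzero at `t
      -- = 1`.
      refine mem_closure_of_line (y := c • f₁ - f) ?_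
      have hcoeff : ∀ (t : ℝ) (i : ℕ), (dehom ((f + t • (c • f₁ - f) : binaryForms (2 * d)) :
          MvPolynomial (Fin 2) ℝ)).coeff i = (dehom f).coeff i +
            t * (c * (dehom f₁).coeff i - (dehom f).coeff i) := by
        intro t i
        simp [-map_smul, dehom_smul]
      have hleadt : ∀ t : ℝ, (dehom ((f + t • (c • f₁ - f) : binaryForms (2 * d)) :
          MvPolynomial (Fin 2) ℝ)).coeff (2 * d) = c := by
        intro t
        rw [hcoeff, hlead, hc]
        ring
      let Q : ℂ[X] := MvPolynomial.aeval (fun i => C (rootSymm f i) +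
        X * C (rootSymm f₁ i - rootSymm f i)) T
      have hQ : ∀ t : ℂ, Q.eval t = MvPolynomial.eval
          (fun i => rootSymm f i + t * (rootSymm f₁ i - rootSymm f i)) T := by
        intro t
        have hid : (evalRingHom t).comp C = RingHom.id ℂ := by ext x; simp
        rw [← coe_evalRingHom, ← MvPolynomial.coe_aeval_eq_eval]
        simp only [Q]
        rw [MvPolynomial.map_aeval]
        simp [hid]
      have hQ0 : Q ≠ 0 := by
        intro h
        have := hQ 1
        rw [h, eval_zero] at this
        apply hsymm₁
        simpa using this.symm
      have hfin : {t : ℝ | ¬ MvPolynomial.eval (rootSymm (f + t • (c • f₁ - f))) T ≠ 0}.Finite := by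
        refine Set.Finite.subset ((Q.roots.toFinset.finite_toSet).preimage
          (Complex.ofReal_injective.injOn)) fun t ht => ?_
        simp only [Set.mem_preimage, Finset.mem_coe, Multiset.mem_toFinset, mem_roots hQ0, IsRoot]
        rw [hQ]
        simp only [ne_eq, not_not, Set.mem_ofPred_eq] at ht
        rw [← ht]
        congr 2
        funext i
        simp only [rootSymm]
        rw [hleadt, hcoeff, hlead, hc]
        field_simp
      filter_upwards [eventually_ne_zero_of_finite hfin, self_mem_nhdsWithin,
        nhdsWithin_le_nhds (Iio_mem_nhds (zero_lt_one (α := ℝ)))] with t ht htpos htlt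
      refine ⟨?_, by rw [hleadt]; exact hcne, ht⟩
      have hlin : f + t • (c • f₁ - f) = (1 - t) • f + (t * c) • f₁ := by module
      rw [hlin]
      exact sosCone_add (sosCone_smul hf (sub_nonneg.2 (le_of_lt htlt)))
        (sosCone_smul hf₁ (mul_nonneg (le_of_lt htpos) hc0))
    exact step₁.trans (closure_minimal step₂ isClosed_closure)
  · rintro f ⟨hf, hf0, hfT⟩
    refine exists_rootPair hf hf0 fun r hr => hgen r ?_
    rw [hST]
    convert hfT using 3
    funext i
    exact (rootSymm_eq hcard hf0 hr i).symm

end OpenDense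

/-! ### Gram tensors of rank two -/

section RankTwo

open Polynomial

variable {d : ℕ}

/-- The product of the linear factors of a choice of roots `ε` over an index set `J`. -/
def facPoly (z : Fin d → ℂ) (ε : Fin d → Bool) (J : Finset (Fin d)) : ℂ[X] :=
  ∏ j ∈ J, (X - C (rootPair z (j, ε j)))

theorem facPoly_monic (z : Fin d → ℂ) (ε : Fin d → Bool) (J : Finset (Fin d)) :
    (facPoly z ε J).Monic :=
  monic_prod_of_monic _ _ fun _ _ => monic_X_sub_C _

theorem natDegree_facPoly (z : Fin d → ℂ) (ε : Fin d → Bool) (J : Finset (Fin d)) :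
    (facPoly z ε J).natDegree = J.card := by
  rw [facPoly, natDegree_prod_of_monic _ _ fun j _ => monic_X_sub_C _]
  simp

theorem star_facPoly (z : Fin d → ℂ) (ε : Fin d → Bool) (J : Finset (Fin d)) :
    (facPoly z ε J).map (starRingEnd ℂ) = facPoly z (fun j => !ε j) J := by
  simp [facPoly, Polynomial.map_prod, rootPair_not]

theorem facPoly_congr {z : Fin d → ℂ} {ε δ : Fin d → Bool} {J : Finset (Fin d)}
    (h : ∀ j ∈ J, ε j = δ j) : facPoly z ε J = facPoly z δ J :=
  Finset.prod_congr rfl fun j hj => by rw [h j hj]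

theorem eval_facPoly (z : Fin d → ℂ) (ε : Fin d → Bool) (J : Finset (Fin d)) (x : ℂ) :
    (facPoly z ε J).eval x = ∏ j ∈ J, (x - rootPair z (j, ε j)) := by
  simp [facPoly, eval_prod]

theorem facPoly_mul_star (z : Fin d → ℂ) (ε : Fin d → Bool) :
    facPoly z ε Finset.univ * (facPoly z ε Finset.univ).map (starRingEnd ℂ) =
      ∏ s, (X - C (rootPair z s)) := by
  rw [star_facPoly, Fintype.prod_prod_type, facPoly, facPoly, ← Finset.prod_mul_distrib]
  refine Finset.prod_congr rfl fun j _ => ?_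
  rw [Fintype.prod_bool]
  cases ε j
  · exact mul_comm _ _
  · rfl

theorem exists_rootForms (z : Fin d → ℂ) (c : ℝ) (ε : Fin d → Bool) :
    ∃ p : binaryForms d × binaryForms d,
      cplx p.1 p.2 = C ((√c : ℝ) : ℂ) * facPoly z ε Finset.univ := by
  obtain ⟨p, q, h⟩ := exists_cplx (n := d)
    (g := C ((√c : ℝ) : ℂ) * facPoly z ε Finset.univ)
    ((natDegree_C_mul_le _ _).trans (by rw [natDegree_facPoly]; simp))
  exact ⟨(p, q), h⟩

/-- Real and imaginary part of the form with leading coefficient `√c` and the roots chosen by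
`ε`. -/
def rootForms (z : Fin d → ℂ) (c : ℝ) (ε : Fin d → Bool) : binaryForms d × binaryForms d :=
  (exists_rootForms z c ε).choose

theorem cplx_rootForms (z : Fin d → ℂ) (c : ℝ) (ε : Fin d → Bool) :
    cplx (rootForms z c ε).1 (rootForms z c ε).2 =
      C ((√c : ℝ) : ℂ) * facPoly z ε Finset.univ :=
  (exists_rootForms z c ε).choose_spec

/-- The Gram tensor of a choice of roots. -/
def rootTensor (z : Fin d → ℂ) (c : ℝ) (ε : Fin d → Bool) : binaryForms d ⊗[ℝ] binaryForms d :=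
  sqTensor (rootForms z c ε).1 (rootForms z c ε).2

/-- The complementary choice conjugates `p + i q`, which only changes the sign of `q`. -/
theorem rootTensor_not (z : Fin d → ℂ) (c : ℝ) (ε : Fin d → Bool) :
    rootTensor z c (fun j => !ε j) = rootTensor z c ε := by
  refine sqTensor_eq_of_star ?_
  rw [cplx_rootForms, cplx_rootForms, Polynomial.map_mul, star_facPoly, map_C, Complex.conj_ofReal]

theorem sqTensor_mem_gram_iff {p q : binaryForms d} {f : binaryForms (2 * d)} :
    sqTensor p q ∈ gram f ↔ cplx p q * (cplx p q).map (starRingEnd ℂ) = dehom f := by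
  have h : mulMap (binaryForms d) (sqTensor p q) = sqForm p q := by
    rw [sqTensor, map_add, mulMap_tmul, mulMap_tmul, coe_sqForm]
  rw [← dehom_sqForm]
  constructor
  · intro hm
    rw [← hm.2, h]
  · intro hm
    refine ⟨isPsd_sqTensor p q, ?_⟩
    rw [h, dehom_injective hm]

variable {f : binaryForms (2 * d)} {z : Fin d → ℂ} {c : ℝ}

theorem rootTensor_mem_gram (hc : 0 < c)
    (hf : dehom f = C (c : ℂ) * ∏ s, (X - C (rootPair z s))) (ε : Fin d → Bool) :
    rootTensor z c ε ∈ gram f := by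
  refine sqTensor_mem_gram_iff.2 ?_
  have h : C ((√c : ℝ) : ℂ) * C ((√c : ℝ) : ℂ) = C (c : ℂ) := by
    rw [← C_mul, ← Complex.ofReal_mul, Real.mul_self_sqrt hc.le]
  rw [cplx_rootForms, Polynomial.map_mul, map_C, Complex.conj_ofReal, hf, ← facPoly_mul_star z ε,
    ← h]
  ring

/-- Every sum of two squares representation arises from a choice of roots. -/
theorem exists_eq_rootTensor (hc : 0 < c)
    (hf : dehom f = C (c : ℂ) * ∏ s, (X - C (rootPair z s)))
    (hinj : Function.Injective (rootPair z)) {p q : binaryForms d} (h : sqTensor p q ∈ gram f) :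
    ∃ ε, sqTensor p q = rootTensor z c ε := by
  have hg := sqTensor_mem_gram_iff.1 h
  set g := cplx p q with hgdef
  have hF0 : dehom f ≠ 0 := by
    rw [hf]
    refine mul_ne_zero (by simpa using hc.ne') (Finset.prod_ne_zero_iff.2 fun s _ =>
      X_sub_C_ne_zero _)
  have hg0 : g ≠ 0 := by
    rintro h0
    rw [h0, zero_mul] at hg
    exact hF0 hg.symm
  -- Since `g ḡ` vanishes at `z j`, `g` vanishes at `z j` or at its conjugate.
  have hroot : ∀ j, ∃ b, g.IsRoot (rootPair z (j, b)) := by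
    intro j
    have h0 : (g * g.map (starRingEnd ℂ)).eval (rootPair z (j, true)) = 0 := by
      rw [hg, hf, eval_mul, eval_prod, Finset.prod_eq_zero (Finset.mem_univ (j, true)) (by simp),
        mul_zero]
    rw [eval_mul, mul_eq_zero] at h0
    rcases h0 with h0 | h0
    · exact ⟨true, h0⟩
    · refine ⟨false, ?_⟩
      have : rootPair z (j, true) = starRingEnd ℂ (rootPair z (j, false)) := rootPair_not z j false
      rw [this, eval_map, eval₂_hom] at h0
      exact (_root_.map_eq_zero _).1 h0
  choose ε hε using hroot
  have hdvd : facPoly z ε Finset.univ ∣ g := by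
    refine Finset.prod_dvd_of_coprime (fun i _ j _ hij => ?_) fun j _ => dvd_iff_isRoot.2 (hε j)
    refine isCoprime_X_sub_C_of_isUnit_sub ?_
    rw [isUnit_iff_ne_zero, sub_ne_zero]
    exact fun h0 => hij (congrArg Prod.fst (hinj h0))
  -- The divisor already has degree `d`, the largest possible for `g`.
  obtain ⟨w, hw⟩ : ∃ w : ℂ, g = C w * facPoly z ε Finset.univ := by
    obtain ⟨q', hq'⟩ := hdvd
    have hd : q'.natDegree = 0 := by
      have h1 : g.natDegree ≤ d := natDegree_cplx_le p q
      have hq0 : q' ≠ 0 := fun h0 => hg0 (by rw [hq', h0, mul_zero])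
      rw [hq', natDegree_mul (facPoly_monic z ε _).ne_zero hq0, natDegree_facPoly,
        Finset.card_univ, Fintype.card_fin] at h1
      omega
    refine ⟨q'.coeff 0, ?_⟩
    rw [← eq_C_of_natDegree_eq_zero hd, mul_comm]
    exact hq'
  have hs : ((√c : ℝ) : ℂ) ≠ 0 := by
    exact_mod_cast (Real.sqrt_pos.2 hc).ne'
  have hww : w * starRingEnd ℂ w = c := by
    have h1 : C (w * starRingEnd ℂ w) * ∏ s, (X - C (rootPair z s)) =
        C (c : ℂ) * ∏ s, (X - C (rootPair z s)) := by
      rw [← hf, ← hg, hw, Polynomial.map_mul, map_C, ← facPoly_mul_star z ε, C_mul]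
      ring
    exact C_injective (mul_right_cancel₀ (Finset.prod_ne_zero_iff.2 fun s _ =>
      X_sub_C_ne_zero _) h1)
  refine ⟨ε, sqTensor_eq_of_cplx (w := w / (√c : ℝ)) ?_ ?_⟩
  · rw [Complex.mul_conj, Complex.normSq_eq_norm_sq] at hww
    have h2 : ‖w‖ ^ 2 = c := by exact_mod_cast hww
    rw [norm_div, Complex.norm_real, Real.norm_eq_abs, abs_of_nonneg (Real.sqrt_nonneg _), ← h2,
      Real.sqrt_sq (norm_nonneg _), div_self]
    intro h0
    rw [h0] at h2
    norm_num at h2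
    exact hc.ne h2
  · rw [← hgdef, hw, cplx_rootForms, ← mul_assoc, ← C_mul, div_mul_cancel₀ _ hs]

/-- A factorization according to the coincidences of two choices of roots. -/
theorem exists_factorization (hc : 0 < c) (hgen : Generic (rootPair z)) {ε δ : Fin d → Bool}
    {A B : Finset (Fin d)} (hA : ∀ j, j ∈ A ↔ ε j = δ j) (hB : ∀ j, j ∈ B ↔ ε j ≠ δ j)
    (hne : A.Nonempty) {k m n : ℕ} (hk : A.card = k) (hm : B.card = m) {e : Fin n → Fin d}
    (he : Function.Injective e) (heB : ∀ i, e i ∈ B) :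
    ∃ (a₁ a₂ : binaryForms k) (b₁ b₂ : binaryForms m) (s : Fin n → ℂ),
      SeparatedRoots a₁ a₂ b₁ b₂ s ∧
      cplx (rootForms z c ε).1 (rootForms z c ε).2 = cplx a₁ a₂ * cplx b₁ b₂ ∧
      cplx (rootForms z c δ).1 (rootForms z c δ).2 =
        cplx a₁ a₂ * (cplx b₁ b₂).map (starRingEnd ℂ) := by
  classical
  have hs : ((√c : ℝ) : ℂ) ≠ 0 := by
    exact_mod_cast (Real.sqrt_pos.2 hc).ne'
  obtain ⟨a₁, a₂, ha⟩ := exists_cplx (n := k) (g := C ((√c : ℝ) : ℂ) * facPoly z ε A)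
    ((natDegree_C_mul_le _ _).trans (by rw [natDegree_facPoly, hk]))
  obtain ⟨b₁, b₂, hb⟩ := exists_cplx (n := m) (g := facPoly z ε B)
    (by rw [natDegree_facPoly, hm])
  have hsplit : ∀ η : Fin d → Bool,
      facPoly z η Finset.univ = facPoly z η A * facPoly z η B := by
    intro η
    have hAB : Disjoint A B := Finset.disjoint_left.2 fun j h1 h2 =>
      (hB j).1 h2 ((hA j).1 h1)
    rw [facPoly, facPoly, facPoly, ← Finset.prod_union hAB]
    congr 1
    ext j
    simp only [Finset.mem_univ, Finset.mem_union, hA, hB, true_iff]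
    exact em _
  have hstar : (facPoly z ε B).map (starRingEnd ℂ) = facPoly z δ B := by
    rw [star_facPoly]
    refine facPoly_congr fun j hj => ?_
    have := (hB j).1 hj
    revert this
    cases ε j <;> cases δ j <;> simp
  refine ⟨a₁, a₂, b₁, b₂, fun i => rootPair z (e i, ε (e i)), ⟨?_, ?_, ?_⟩, ?_, ?_⟩
  · intro i
    rw [hb, eval_facPoly, Finset.prod_eq_zero (heB i) (sub_self _)]
  · intro i
    rw [hb, star_facPoly, eval_facPoly]
    refine Finset.prod_ne_zero_iff.2 fun j _ => sub_ne_zero.2 fun h0 => ?_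
    have := hgen.injective h0
    rw [Prod.mk.injEq] at this
    obtain ⟨rfl, h1⟩ := this
    cases h2 : ε (e i) <;> simp [h2] at h1
  · intro i j hij h0
    rw [ha, Polynomial.map_mul, map_C, Complex.conj_ofReal, star_facPoly] at h0
    simp only [eval_mul, eval_C, eval_facPoly] at h0
    have hinjA : ∀ η : Fin d → Bool, Set.InjOn (fun j => (j, η j)) (A : Set (Fin d)) :=
      fun η x _ y _ hxy => congrArg Prod.fst hxy
    have hnot : ∀ (η : Fin d → Bool) (i : Fin n), (e i, ε (e i)) ∉ A.image fun j => (j, η j) := by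
      intro η i h1
      obtain ⟨x, hx, hxe⟩ := Finset.mem_image.1 h1
      have : x = e i := congrArg Prod.fst hxe
      exact (hB _).1 (heB i) ((hA _).1 (this ▸ hx))
    -- Genericity is applied to the roots of `a` and those of `ā`. Nonemptiness of `A` is needed:
    -- for constant `a` all the ratios coincide.
    refine hgen.separated (A.image fun j => (j, ε j)) (A.image fun j => (j, !ε j))
      (e i, ε (e i)) (e j, ε (e j)) (hne.image _) ?_ ?_ (hnot _ _) (hnot _ _) (hnot _ _) ?_
    · refine Finset.disjoint_left.2 fun x h1 h2 => ?_
      obtain ⟨y, -, rfl⟩ := Finset.mem_image.1 h1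
      obtain ⟨w, -, hw⟩ := Finset.mem_image.1 h2
      rw [Prod.mk.injEq] at hw
      obtain ⟨rfl, h3⟩ := hw
      cases h4 : ε w <;> simp [h4] at h3
    · exact fun h1 => hij (he (congrArg Prod.fst h1))
    · rw [Finset.prod_image (hinjA _), Finset.prod_image (hinjA _), Finset.prod_image (hinjA _),
        Finset.prod_image (hinjA _)]
      apply mul_left_cancel₀ (mul_ne_zero hs hs)
      linear_combination h0
  · rw [cplx_rootForms, ha, hb, hsplit]
    ring
  · rw [cplx_rootForms, ha, hb, hstar, hsplit, facPoly_congr fun j hj => ((hA j).1 hj).symm]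
    ring

/-- With a single point the separation condition is void, so the pair itself can serve as the left
pair. -/
theorem exists_separated_self (hc : 0 < c) (hgen : Generic (rootPair z)) (ε : Fin d → Bool)
    (j : Fin d) : ∃ s : Fin 1 → ℂ, SeparatedRoots (rootForms z c ε).1 (rootForms z c ε).2
      (rootForms z c ε).1 (rootForms z c ε).2 s := by
  have hs : ((√c : ℝ) : ℂ) ≠ 0 := by
    exact_mod_cast (Real.sqrt_pos.2 hc).ne'
  refine ⟨fun _ => rootPair z (j, ε j), ?_, ?_, fun i i' h => absurd (Subsingleton.elim i i') h⟩
  · intro i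
    rw [cplx_rootForms, eval_mul, eval_facPoly, Finset.prod_eq_zero (Finset.mem_univ j)
      (sub_self _), mul_zero]
  · intro i
    rw [cplx_rootForms, Polynomial.map_mul, map_C, Complex.conj_ofReal, star_facPoly, eval_mul,
      eval_C, eval_facPoly]
    refine mul_ne_zero hs (Finset.prod_ne_zero_iff.2 fun x _ => sub_ne_zero.2 fun h0 => ?_)
    have := hgen.injective h0
    rw [Prod.mk.injEq] at this
    obtain ⟨rfl, h1⟩ := this
    cases h2 : ε j <;> simp [h2] at h1

theorem SeparatedRoots.linearIndependent_right {k m n : ℕ} {a₁ a₂ : binaryForms k}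
    {b₁ b₂ : binaryForms m} {s : Fin n → ℂ} (h : SeparatedRoots a₁ a₂ b₁ b₂ s) (i : Fin n) :
    LinearIndependent ℝ ![b₁, b₂] :=
  LinearIndependent.pair_iff.2 fun _ _ h0 => h.right_eq_zero i h0

/-- A sum of two squares `p² + q²` gives an extreme point if `p + i q` has a root that is not a
root of its conjugate. -/
theorem SeparatedRoots.mem_extremePoints {k n : ℕ} {a₁ a₂ : binaryForms k} {p q : binaryForms d}
    {s : Fin n → ℂ} (h : SeparatedRoots a₁ a₂ p q s) (i : Fin n) (hmem : sqTensor p q ∈ gram f) :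
    sqTensor p q ∈ (gram f).extremePoints ℝ := by
  have hu := h.linearIndependent_right i
  refine ⟨hmem, ?_⟩
  rintro x hx y hy ⟨t, t', ht, ht', -, hxy⟩
  rw [sqTensor_eq_gramTensor] at hxy hmem ⊢
  obtain ⟨e, he, rfl⟩ := hx.1.exists_gramTensor_of_add hu hy.1 ht ht'.le hxy
  have h1 : dehom (mulMap _ (gramTensor ![p, q] e)) = dehom (mulMap _ (gramTensor ![p, q] 1)) := by
    rw [hx.2, hmem.2]
  have h10 : e 1 0 = e 0 1 := he.apply _ _
  rw [dehom_mulMap_gramTensor, dehom_mulMap_gramTensor] at h1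
  simp [Fin.sum_univ_two, Matrix.one_apply, h10] at h1
  -- Evaluating at a root of `p + i q`, where `p = -i q`. The real and imaginary parts make `e` a
  -- scalar matrix, and comparison with `p² + q²` makes the scalar `1`.
  have h2 : ((e 1 1 : ℝ) : ℂ) - e 0 0 - 2 * Complex.I * e 0 1 = 0 := by
    have := congrArg (eval (s i)) h1
    simp only [eval_add, eval_mul, eval_C, h.eval_left i] at this
    refine (mul_eq_zero.1 ?_).resolve_right (pow_ne_zero 2 (h.eval_right_ne_zero i))
    linear_combination this - ((e 0 0 : ℂ) - 1) * (eval (s i) (dehom q)) ^ 2 * Complex.I_sq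
  rw [Complex.ext_iff] at h2
  simp at h2
  obtain ⟨h3, h4⟩ := h2
  have h5 : e 1 1 = e 0 0 := by linarith
  rw [h5, h4] at h1
  have h6 : C (((e 0 0 : ℝ) : ℂ) - 1) = 0 := by
    refine (mul_eq_zero.1 ?_).resolve_right (h.normSq_ne_zero i)
    simp only [C_sub, C_1]
    simp only [Complex.ofReal_zero, C_0] at h1
    linear_combination h1
  have h7 : e 0 0 = 1 := by
    rw [C_eq_zero, sub_eq_zero] at h6
    exact_mod_cast h6
  congr 1
  ext i j
  fin_cases i <;> fin_cases j <;> simp [h7, h4, h5, h10]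

/-- The extreme points of rank two are the tensors of the choices of roots. -/
theorem exRank_two_eq_range (hd : 0 < d) (hc : 0 < c)
    (hf : dehom f = C (c : ℂ) * ∏ s, (X - C (rootPair z s))) (hgen : Generic (rootPair z)) :
    exRank 2 f = Set.range (rootTensor z c) := by
  ext θ
  constructor
  · rintro ⟨hθ, hr⟩
    obtain ⟨p, q, rfl⟩ := hθ.1.1.exists_sqTensor hr
    obtain ⟨ε, hε⟩ := exists_eq_rootTensor hc hf hgen.injective hθ.1
    exact ⟨ε, hε.symm⟩
  · rintro ⟨ε, rfl⟩
    obtain ⟨s, hs⟩ := exists_separated_self hc hgen ε ⟨0, hd⟩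
    exact ⟨hs.mem_extremePoints 0 (rootTensor_mem_gram hc hf ε),
      tensorRank_sqTensor (hs.linearIndependent_right 0)⟩

/-! ### Segments between two choices of roots -/

/-- The indices at which two choices differ. -/
def diffSet (ε δ : Fin d → Bool) : Finset (Fin d) := Finset.univ.filter fun j => ε j ≠ δ j

theorem mem_diffSet {ε δ : Fin d → Bool} (j : Fin d) : j ∈ diffSet ε δ ↔ ε j ≠ δ j := by
  simp [diffSet]

theorem mem_diffSet_not {ε δ : Fin d → Bool} (j : Fin d) :
    j ∈ diffSet ε (fun j => !δ j) ↔ ε j = δ j := by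
  rw [mem_diffSet]
  cases ε j <;> cases δ j <;> simp

theorem card_diffSet_add (ε δ : Fin d → Bool) :
    (diffSet ε (fun j => !δ j)).card + (diffSet ε δ).card = d := by
  have h : diffSet ε (fun j => !δ j) = (diffSet ε δ)ᶜ := by
    ext j
    rw [mem_diffSet_not, Finset.mem_compl, mem_diffSet, not_not]
  rw [h, Finset.card_compl_add_card, Fintype.card_fin]

theorem exists_injective_of_le_card {n : ℕ} {B : Finset (Fin d)} (h : n ≤ B.card) :
    ∃ e : Fin n → Fin d, Function.Injective e ∧ ∀ i, e i ∈ B :=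
  ⟨fun i => B.equivFin.symm (Fin.castLE h i), fun i j hij => by
    simpa using hij, fun i => (B.equivFin.symm _).2⟩

theorem isFace_segment_of_three_le (hc : 0 < c)
    (hf : dehom f = C (c : ℂ) * ∏ s, (X - C (rootPair z s))) (hgen : Generic (rootPair z))
    {ε δ : Fin d → Bool} (h3 : 3 ≤ (diffSet ε δ).card) (hne : ε ≠ fun j => !δ j) :
    IsFace (gram f) (segment ℝ (rootTensor z c ε) (rootTensor z c δ)) := by
  obtain ⟨e, he, heB⟩ := exists_injective_of_le_card h3
  have hA : (diffSet ε (fun j => !δ j)).Nonempty := by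
    obtain ⟨j, hj⟩ := Function.ne_iff.1 hne
    exact ⟨j, (mem_diffSet j).2 hj⟩
  obtain ⟨a₁, a₂, b₁, b₂, s, hs, h1, h2⟩ := exists_factorization hc hgen (ε := ε) (δ := δ)
    mem_diffSet_not mem_diffSet hA rfl rfl he heB
  exact isFace_segment_of_factorization (card_diffSet_add ε δ) hs h1 h2
    (rootTensor_mem_gram hc hf ε)

/-- Complementing `δ` leaves its tensor unchanged and exchanges agreements with differences. -/
theorem isFace_segment_of_three_le_not (hc : 0 < c)
    (hf : dehom f = C (c : ℂ) * ∏ s, (X - C (rootPair z s))) (hgen : Generic (rootPair z))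
    {ε δ : Fin d → Bool} (h3 : 3 ≤ (diffSet ε fun j => !δ j).card) (hne : ε ≠ δ) :
    IsFace (gram f) (segment ℝ (rootTensor z c ε) (rootTensor z c δ)) := by
  rw [← rootTensor_not z c δ]
  exact isFace_segment_of_three_le hc hf hgen h3 (by simpa using hne)

theorem not_isFace_segment_of_two {f : binaryForms (2 * 4)} {z : Fin 4 → ℂ} (hc : 0 < c)
    (hf : dehom f = C (c : ℂ) * ∏ s, (X - C (rootPair z s))) (hgen : Generic (rootPair z))
    {ε δ : Fin 4 → Bool} (h2 : (diffSet ε δ).card = 2) :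
    ¬ IsFace (gram f) (segment ℝ (rootTensor z c ε) (rootTensor z c δ)) := by
  obtain ⟨e, he, heB⟩ := exists_injective_of_le_card h2.ge
  have hA := card_diffSet_add ε δ
  have hA2 : (diffSet ε (fun j => !δ j)).card = 2 := by omega
  obtain ⟨a₁, a₂, b₁, b₂, s, hs, h1, h2⟩ := exists_factorization hc hgen (ε := ε) (δ := δ)
    mem_diffSet_not mem_diffSet (Finset.card_pos.1 (by omega)) hA2 h2 he heB
  exact not_isFace_segment_of_factorization rfl hs h1 h2 (rootTensor_mem_gram hc hf ε)

/-- The two tensors are the ends `t = ±1` of a pencil on independent products. -/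
theorem rootTensor_ne_of_two_le (hc : 0 < c) (hgen : Generic (rootPair z)) {ε δ : Fin d → Bool}
    (h2 : 2 ≤ (diffSet ε δ).card) (hne : ε ≠ fun j => !δ j) :
    rootTensor z c ε ≠ rootTensor z c δ := by
  obtain ⟨e, he, heB⟩ := exists_injective_of_le_card h2
  have hA : (diffSet ε (fun j => !δ j)).Nonempty := by
    obtain ⟨j, hj⟩ := Function.ne_iff.1 hne
    exact ⟨j, (mem_diffSet j).2 hj⟩
  obtain ⟨a₁, a₂, b₁, b₂, s, hs, h1, h2⟩ := exists_factorization hc hgen (ε := ε) (δ := δ)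
    mem_diffSet_not mem_diffSet hA rfl rfl he heB
  have hu := linearIndependent_prodFamily (card_diffSet_add ε δ) hs
  rw [rootTensor, rootTensor, sqTensor_eq_pencil_one (card_diffSet_add ε δ) (a₁ := a₁) (a₂ := a₂)
    (b₁ := b₁) (b₂ := b₂) (w := 1) (by simp) (by rw [h1, C_1, one_mul]),
    sqTensor_eq_pencil_neg_one (card_diffSet_add ε δ) (a₁ := a₁) (a₂ := a₂)
    (b₁ := b₁) (b₂ := b₂) (w := 1) (by simp) (by rw [h2, C_1, one_mul])]
  intro h0
  have := congrFun (congrFun (gramTensor_injective hu h0) 1) 2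
  simp [pencilMatrix] at this
  norm_num at this

theorem rootTensor_ne (hd : 3 ≤ d) (hc : 0 < c) (hgen : Generic (rootPair z))
    {ε δ : Fin d → Bool} (hne : ε ≠ δ) (hne' : ε ≠ fun j => !δ j) :
    rootTensor z c ε ≠ rootTensor z c δ := by
  rcases le_or_gt 2 (diffSet ε δ).card with h | h
  · exact rootTensor_ne_of_two_le hc hgen h hne'
  · rw [← rootTensor_not z c δ]
    have := card_diffSet_add ε δ
    exact rootTensor_ne_of_two_le hc hgen (by omega) (by simpa using hne)

end RankTwo

/-! ### Segments in the relative boundary -/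

section Boundary

open Polynomial Filter Topology

variable {d : ℕ}

/-- The products of choices of roots span all polynomials of bounded degree. -/
theorem mem_of_forall_facPoly_mem {z : Fin d → ℂ} (hinj : Function.Injective (rootPair z))
    (J : Finset (Fin d)) (W : Submodule ℂ ℂ[X]) (hW : ∀ ε, facPoly z ε J ∈ W) {g : ℂ[X]}
    (hg : g.natDegree ≤ J.card) : g ∈ W := by
  classical
  induction J using Finset.induction_on generalizing W g with
  | empty =>
    rw [Finset.card_empty, Nat.le_zero] at hg
    rw [eq_C_of_natDegree_eq_zero hg, ← mul_one (C _), ← smul_eq_C_mul]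
    exact W.smul_mem _ (by simpa [facPoly] using hW fun _ => true)
  | insert j J hj ih =>
    rw [Finset.card_insert_of_notMem hj] at hg
    have hmul : ∀ (b : Bool) (h : ℂ[X]), h.natDegree ≤ J.card →
        (X - C (rootPair z (j, b))) * h ∈ W := by
      intro b h hh
      refine ih (W.comap (LinearMap.mulLeft ℂ (X - C (rootPair z (j, b))))) (fun ε => ?_) hh
      have := hW (Function.update ε j b)
      rw [facPoly, Finset.prod_insert hj] at this
      simp only [Function.update_self] at this
      rw [Submodule.mem_comap, LinearMap.mulLeft_apply]
      convert this using 2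
      refine Finset.prod_congr rfl fun i hi => ?_
      rw [Function.update_of_ne (ne_of_mem_of_not_mem hi hj)]
    have hne : rootPair z (j, false) - rootPair z (j, true) ≠ 0 :=
      sub_ne_zero.2 fun h => by simpa using hinj h
    -- The two linear factors at `j` differ by a nonzero constant, so `W` contains the polynomials
    -- of degree at most `J.card`; a multiple of one linear factor reaches the next degree.
    have hlow : ∀ h : ℂ[X], h.natDegree ≤ J.card → h ∈ W := by
      intro h hh
      have h1 := W.sub_mem (hmul true h hh) (hmul false h hh)
      have h2 : (X - C (rootPair z (j, true))) * h - (X - C (rootPair z (j, false))) * h =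
          (rootPair z (j, false) - rootPair z (j, true)) • h := by
        rw [smul_eq_C_mul, C_sub]; ring
      rw [h2] at h1
      exact (W.smul_mem_iff hne).1 h1
    have hdiv : g.divX.natDegree ≤ J.card := by
      rw [natDegree_divX_eq_natDegree_tsub_one]; omega
    have h3 : g = (X - C (rootPair z (j, true))) * g.divX +
        (rootPair z (j, true) • g.divX + C (g.coeff 0)) := by
      conv_lhs => rw [← divX_mul_X_add g]
      rw [smul_eq_C_mul]; ring
    rw [h3]
    exact W.add_mem (hmul true _ hdiv) (W.add_mem (W.smul_mem _ (hlow _ hdiv))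
      (hlow _ (by rw [natDegree_C]; exact Nat.zero_le _)))

/-- A linear functional that vanishes on all root forms is zero. -/
theorem exists_rootForms_apply_ne_zero {z : Fin d → ℂ} (hinj : Function.Injective (rootPair z))
    {c : ℝ} (hc : 0 < c) {l : Module.Dual ℝ (binaryForms d)} (hl : l ≠ 0) :
    ∃ ε, l (rootForms z c ε).1 ≠ 0 ∨ l (rootForms z c ε).2 ≠ 0 := by
  by_contra! hcon
  apply hl
  -- The kernel of the complexification of `l`. If `l` kills all root forms, `W` contains every
  -- polynomial of degree at most `d`.
  let W : Submodule ℂ ℂ[X] :=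
    { carrier := {g | ∃ p q : binaryForms d, l p = 0 ∧ l q = 0 ∧ cplx p q = g}
      zero_mem' := ⟨0, 0, map_zero _, map_zero _, by simp [cplx]⟩
      add_mem' := by
        rintro _ _ ⟨p, q, hp, hq, rfl⟩ ⟨p', q', hp', hq', rfl⟩
        refine ⟨p + p', q + q', by rw [map_add, hp, hp', add_zero],
          by rw [map_add, hq, hq', add_zero], ?_⟩
        simp only [cplx, Submodule.coe_add, map_add]
        ring
      smul_mem' := by
        rintro w _ ⟨p, q, hp, hq, rfl⟩
        refine ⟨w.re • p - w.im • q, w.im • p + w.re • q, by simp [hp, hq], by simp [hp, hq], ?_⟩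
        rw [← smul_cplx, Complex.re_add_im, smul_eq_C_mul] }
  have hs : ((√c : ℝ) : ℂ) ≠ 0 := by
    exact_mod_cast (Real.sqrt_pos.2 hc).ne'
  have hW : ∀ ε, facPoly z ε Finset.univ ∈ W := by
    intro ε
    rw [← W.smul_mem_iff hs, smul_eq_C_mul, ← cplx_rootForms]
    exact ⟨_, _, (hcon ε).1, (hcon ε).2, rfl⟩
  ext p
  obtain ⟨p', q', hp', -, h⟩ := mem_of_forall_facPoly_mem hinj Finset.univ W hW (g := cplx p 0)
    (by rw [Finset.card_univ, Fintype.card_fin]; exact natDegree_cplx_le _ _)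
  rw [← (cplx_injective h).1, hp', LinearMap.zero_apply]

/-- Prolonging the segment from `θ₀` beyond `θ` makes the form negative at `l`, so it leaves the
Gram spectrahedron at once while staying in its affine hull. -/
theorem mem_relBoundary {A : Type*} [CommRing A] [Algebra ℝ A] {V : Submodule ℝ A} {f : A}
    {θ θ₀ : V ⊗[ℝ] V} (hθ : θ ∈ gramRel V f) (hθ₀ : θ₀ ∈ gramRel V f) {l : Module.Dual ℝ V}
    (h : l (tensorMap θ l) = 0) (h₀ : 0 < l (tensorMap θ₀ l)) :
    θ ∈ relBoundary (gramRel V f) := by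
  unfold relBoundary
  let _ : TopologicalSpace (V ⊗[ℝ] V) := moduleTopology ℝ _
  have : ContinuousAdd (V ⊗[ℝ] V) := ModuleTopology.continuousAdd ℝ _
  have : ContinuousSMul ℝ (V ⊗[ℝ] V) := ModuleTopology.continuousSMul ℝ _
  have hmem := subset_affineSpan ℝ (gramRel V f)
  rw [mem_intrinsicFrontier]
  refine ⟨⟨θ, hmem hθ⟩, ⟨subset_closure hθ, fun hint => ?_⟩, rfl⟩
  let γ : ℝ → V ⊗[ℝ] V := fun t => (1 + t) • θ + (-t) • θ₀
  have hγmem : ∀ t, γ t ∈ affineSpan ℝ (gramRel V f) := by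
    intro t
    have := AffineMap.lineMap_mem (-t) (hmem hθ) (hmem hθ₀)
    rw [AffineMap.lineMap_apply_module] at this
    rw [sub_neg_eq_add] at this
    exact this
  let γ' : ℝ → affineSpan ℝ (gramRel V f) := fun t => ⟨γ t, hγmem t⟩
  have hcont : Continuous γ' := Continuous.subtype_mk (by fun_prop) _
  have hγ0 : γ' 0 = ⟨θ, hmem hθ⟩ := Subtype.ext (by simp [γ', γ])
  have hev : ∀ᶠ t : ℝ in 𝓝 0, γ t ∈ gramRel V f := by
    have h1 : interior ((↑) ⁻¹' gramRel V f : Set (affineSpan ℝ (gramRel V f))) ∈ 𝓝 (γ' 0) := by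
      rw [hγ0]
      exact isOpen_interior.mem_nhds hint
    filter_upwards [hcont.tendsto 0 h1] with t ht
    have ht' := interior_subset (Set.mem_preimage.1 ht)
    exact ht'
  obtain ⟨t, ht, htpos⟩ :=
    ((hev.filter_mono nhdsWithin_le_nhds).and (self_mem_nhdsWithin (s := Set.Ioi 0))).exists
  have h2 := ht.1.2 l
  simp only [γ, tensorMap_add, tensorMap_smul, LinearMap.add_apply, LinearMap.smul_apply, map_add,
    map_smul, smul_eq_mul, h] at h2
  have htpos' : (0 : ℝ) < t := htpos
  nlinarith [mul_pos htpos' h₀]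

theorem apply_tensorMap_sqTensor {V : Type*} [AddCommGroup V] [Module ℝ V] (p q : V)
    (l : Module.Dual ℝ V) : l (tensorMap (sqTensor p q) l) = l p ^ 2 + l q ^ 2 := by
  rw [tensorMap_sqTensor]
  simp [sq]

/-- The four forms of the two choices span a proper subspace because `d + 1 > 4`; a functional
killing them is isotropic along the whole segment but not for some other root tensor. -/
theorem segment_rootTensor_subset_relBoundary {f : binaryForms (2 * d)} {z : Fin d → ℂ} {c : ℝ}
    (hd : 4 ≤ d) (hc : 0 < c) (hf : dehom f = C (c : ℂ) * ∏ s, (X - C (rootPair z s)))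
    (hgen : Generic (rootPair z)) (ε δ : Fin d → Bool)
    (hsub : segment ℝ (rootTensor z c ε) (rootTensor z c δ) ⊆ gram f) :
    segment ℝ (rootTensor z c ε) (rootTensor z c δ) ⊆ relBoundary (gram f) := by
  let u : Fin 4 → binaryForms d := ![(rootForms z c ε).1, (rootForms z c ε).2,
    (rootForms z c δ).1, (rootForms z c δ).2]
  have hlt : Submodule.span ℝ (Set.range u) < ⊤ := by
    refine lt_top_iff_ne_top.2 fun htop => ?_
    have h1 := finrank_range_le_card (R := ℝ) u
    rw [Set.finrank, htop, finrank_top, finrank_binaryForms, Fintype.card_fin] at h1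
    omega
  obtain ⟨x, -, hx⟩ := SetLike.exists_of_lt hlt
  obtain ⟨l, hlx, hl⟩ := Submodule.exists_dual_map_eq_bot_of_notMem hx inferInstance
  have hlu : ∀ i, l (u i) = 0 := fun i => by
    have : l (u i) ∈ Submodule.map l (Submodule.span ℝ (Set.range u)) :=
      Submodule.mem_map_of_mem (Submodule.subset_span ⟨i, rfl⟩)
    rwa [hl, Submodule.mem_bot] at this
  have hl0 : l ≠ 0 := fun h => hlx (by rw [h, LinearMap.zero_apply])
  obtain ⟨η, hη⟩ := exists_rootForms_apply_ne_zero hgen.injective hc hl0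
  have hpos : 0 < l (tensorMap (rootTensor z c η) l) := by
    rw [rootTensor, apply_tensorMap_sqTensor]
    rcases hη with h | h <;> positivity
  rintro θ hθ
  refine mem_relBoundary (hsub hθ) (rootTensor_mem_gram hc hf η) ?_ hpos
  obtain ⟨s, t, -, -, -, rfl⟩ := hθ
  simp only [tensorMap_add, tensorMap_smul, LinearMap.add_apply, LinearMap.smul_apply, map_add,
    map_smul, smul_eq_mul, rootTensor, apply_tensorMap_sqTensor]
  have h0 : l (rootForms z c ε).1 = 0 := hlu 0
  have h1 : l (rootForms z c ε).2 = 0 := hlu 1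
  have h2 : l (rootForms z c δ).1 = 0 := hlu 2
  have h3 : l (rootForms z c δ).2 = 0 := hlu 3
  simp [h0, h1, h2, h3]

theorem convex_gramRel {A : Type*} [CommRing A] [Algebra ℝ A] (V : Submodule ℝ A) (f : A) :
    Convex ℝ (gramRel V f) := by
  rintro x hx y hy a b ha hb hab
  refine ⟨⟨?_, fun l => ?_⟩, ?_⟩
  · have h1 : TensorProduct.comm ℝ V V x = x := hx.1.1
    have h2 : TensorProduct.comm ℝ V V y = y := hy.1.1
    simp only [IsSymmetric, map_add, map_smul, h1, h2]
  · simp only [tensorMap_add, tensorMap_smul, LinearMap.add_apply, LinearMap.smul_apply, map_add,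
      map_smul, smul_eq_mul]
    exact add_nonneg (mul_nonneg ha (hx.1.2 l)) (mul_nonneg hb (hy.1.2 l))
  · rw [map_add, map_smul, map_smul, hx.2, hy.2, ← add_smul, hab, one_smul]

end Boundary

/-! ### The graph for `d = 4` -/

section Graph

open Polynomial

/-- Representatives of the choices of roots up to complement, sorted by parity. -/
def signRep : Fin 4 ⊕ Fin 4 → Fin 4 → Bool
  -- As subsets: `inl i` is `{0, i}`, or empty when `i = 0`, and `inr i` is `{i}`.
  | .inl i, j => (i != 0) && (j == 0 || j == i)
  | .inr i, j => j == i

theorem signRep_same_side : ∀ x y, x ≠ y → x.isLeft = y.isLeft →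
    (diffSet (signRep x) (signRep y)).card = 2 := by
  unfold diffSet
  decide

theorem signRep_other_side : ∀ x y, x.isLeft ≠ y.isLeft →
    (diffSet (signRep x) (signRep y)).card = 1 ∨ (diffSet (signRep x) (signRep y)).card = 3 := by
  unfold diffSet
  decide

theorem signRep_ne : ∀ x y, x ≠ y →
    signRep x ≠ signRep y ∧ signRep x ≠ fun j => !signRep y j := by
  decide

theorem exists_signRep : ∀ ε : Fin 4 → Bool, ∃ x, ε = signRep x ∨ ε = fun j => !signRep x j := by
  decide

variable {f : binaryForms (2 * 4)} {z : Fin 4 → ℂ} {c : ℝ}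

/-- The extreme points of rank two for `d = 4`. -/
def signEquiv (hc : 0 < c) (hf : dehom f = C (c : ℂ) * ∏ s, (X - C (rootPair z s)))
    (hgen : Generic (rootPair z)) : Fin 4 ⊕ Fin 4 ≃ exRank 2 f :=
  Equiv.ofBijective
    (fun x => ⟨rootTensor z c (signRep x), by
      rw [exRank_two_eq_range (by norm_num) hc hf hgen]; exact ⟨_, rfl⟩⟩)
    ⟨fun x y hxy => by
      by_contra hne
      obtain ⟨h1, h2⟩ := signRep_ne x y hne
      exact rootTensor_ne (by norm_num) hc hgen h1 h2 (congrArg Subtype.val hxy),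
    fun ⟨θ, hθ⟩ => by
      have hθ' := hθ
      rw [exRank_two_eq_range (by norm_num) hc hf hgen] at hθ'
      obtain ⟨ε, rfl⟩ := hθ'
      obtain ⟨x, rfl | rfl⟩ := exists_signRep ε
      · exact ⟨x, rfl⟩
      · exact ⟨x, Subtype.ext (rootTensor_not z c _).symm⟩⟩

/-- Opposite parity means a split `1 + 3`, which gives an edge; equal parity means `2 + 2`, which
does not. -/
theorem isFace_signRep_iff (hc : 0 < c) (hf : dehom f = C (c : ℂ) * ∏ s, (X - C (rootPair z s)))
    (hgen : Generic (rootPair z)) {x y : Fin 4 ⊕ Fin 4} (hne : x ≠ y) :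
    IsFace (gram f) (segment ℝ (rootTensor z c (signRep x)) (rootTensor z c (signRep y))) ↔
      x.isLeft ≠ y.isLeft := by
  obtain ⟨h1, h2⟩ := signRep_ne x y hne
  constructor
  · intro h hxy
    exact not_isFace_segment_of_two hc hf hgen (signRep_same_side x y hne hxy) h
  · intro h
    rcases signRep_other_side x y h with h3 | h3
    · have := card_diffSet_add (signRep x) (signRep y)
      exact isFace_segment_of_three_le_not hc hf hgen (by omega) h1
    · exact isFace_segment_of_three_le hc hf hgen h3.ge h2

/-- The edge graph for `d = 4` is complete bipartite. -/
def edgeGraphIso (hc : 0 < c) (hf : dehom f = C (c : ℂ) * ∏ s, (X - C (rootPair z s)))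
    (hgen : Generic (rootPair z)) :
    completeBipartiteGraph (Fin 4) (Fin 4) ≃g edgeGraph f where
  toEquiv := signEquiv hc hf hgen
  map_rel_iff' := by
    intro x y
    have hadj : (edgeGraph f).Adj (signEquiv hc hf hgen x) (signEquiv hc hf hgen y) ↔
        x ≠ y ∧ IsFace (gram f)
          (segment ℝ (rootTensor z c (signRep x)) (rootTensor z c (signRep y))) :=
      and_congr_left' (signEquiv hc hf hgen).injective.ne_iff
    rw [hadj]
    constructor
    · rintro ⟨hne, h⟩
      rw [isFace_signRep_iff hc hf hgen hne] at h
      revert h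
      rcases x with x | x <;> rcases y with y | y <;> simp
    · intro h
      refine ⟨h.ne, (isFace_signRep_iff hc hf hgen h.ne).2 ?_⟩
      revert h
      rcases x with x | x <;> rcases y with y | y <;> simp

instance : DecidableRel (completeBipartiteGraph (Fin 4) (Fin 4)).Adj := fun x y =>
  inferInstanceAs (Decidable (x.isLeft ∧ y.isRight ∨ x.isRight ∧ y.isLeft))

theorem ncard_edgeSet_completeBipartiteGraph :
    (completeBipartiteGraph (Fin 4) (Fin 4)).edgeSet.ncard = 16 := by
  have h : (completeBipartiteGraph (Fin 4) (Fin 4)).edgeFinset.card = 16 := by decide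
  rw [← h, ← SimpleGraph.coe_edgeFinset, Set.ncard_coe_finset]

end Graph

end

end GramSpectrahedron

theorem theorem6p2 (d : ℕ) (hd : 4 ≤ d) :
    ∃ U : Set (GramSpectrahedron.binaryForms (2 * d)),
      GramSpectrahedron.IsOpenDenseIn U (GramSpectrahedron.sosCone d) ∧
      ∀ f ∈ U,
        (d = 4 →
          (GramSpectrahedron.exRank 2 f).ncard = 8 ∧
          {e : Sym2 (GramSpectrahedron.exRank 2 f) | ¬ e.IsDiag}.ncard = 28 ∧
          (∀ θ ∈ GramSpectrahedron.exRank 2 f, ∀ η ∈ GramSpectrahedron.exRank 2 f, θ ≠ η →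
            segment ℝ θ η ⊆ GramSpectrahedron.relBoundary (GramSpectrahedron.gram f)) ∧
          (GramSpectrahedron.edgeGraph f).edgeSet.ncard = 16 ∧
          Nonempty (GramSpectrahedron.edgeGraph f ≃g
            completeBipartiteGraph (Fin 4) (Fin 4))) ∧
        (5 ≤ d →
          ∀ θ ∈ GramSpectrahedron.exRank 2 f, ∀ η ∈ GramSpectrahedron.exRank 2 f, θ ≠ η →
            GramSpectrahedron.IsFace (GramSpectrahedron.gram f) (segment ℝ θ η)) := by
  obtain ⟨U, hU, hgen⟩ := GramSpectrahedron.exists_isOpenDenseIn_generic d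
  refine ⟨U, hU, fun f hfU => ?_⟩
  obtain ⟨z, c, hc, hf, hz⟩ := hgen f hfU
  have hrange := GramSpectrahedron.exRank_two_eq_range (by omega) hc hf hz
  constructor
  · rintro rfl
    have e := GramSpectrahedron.signEquiv hc hf hz
    have iso := GramSpectrahedron.edgeGraphIso hc hf hz
    have hcard : Nat.card (GramSpectrahedron.exRank 2 f) = 8 := by
      rw [← Nat.card_congr e]
      simp
    refine ⟨hcard, ?_, ?_, ?_, ⟨iso.symm⟩⟩
    · have := Sym2.natCard_subtype_not_diag (α := GramSpectrahedron.exRank 2 f)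
      rw [hcard] at this
      exact this
    · intro θ hθ η hη _
      have hsub := (GramSpectrahedron.convex_gramRel _ _).segment_subset hθ.1.1 hη.1.1
      rw [hrange] at hθ hη
      obtain ⟨ε, rfl⟩ := hθ
      obtain ⟨δ, rfl⟩ := hη
      exact GramSpectrahedron.segment_rootTensor_subset_relBoundary le_rfl hc hf hz ε δ hsub
    · rw [← GramSpectrahedron.ncard_edgeSet_completeBipartiteGraph]
      exact (Nat.card_congr iso.mapEdgeSet).symm
  · intro hd5 θ hθ η hη hne
    rw [hrange] at hθ hη
    obtain ⟨ε, rfl⟩ := hθ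
    obtain ⟨δ, rfl⟩ := hη
    have h1 : ε ≠ δ := fun h => hne (by rw [h])
    have h2 : ε ≠ fun j => !δ j := fun h => hne (by
      rw [h, GramSpectrahedron.rootTensor_not])
    have h3 := GramSpectrahedron.card_diffSet_add ε δ
    -- Agreements and differences number `d ≥ 5` together, so one of the two sets has at least three
    -- elements.
    rcases le_or_gt 3 (GramSpectrahedron.diffSet ε δ).card with h4 | h4
    · exact GramSpectrahedron.isFace_segment_of_three_le hc hf hz h4 h2
    · exact GramSpectrahedron.isFace_segment_of_three_le_not hc hf hz (by omega) h1
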